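/- Let $S$ be a closed connected surface with a half-translation structure $q$ and a finite non-empty set $Z \subset S$ of marked points. That is, $S \setminus Z$ has an atlas of charts to $\mathbb{C}$ with transition functions $w \mapsto \pm w + c$, and every $z \in Z$ is a cone point of angle $k\pi$ for some integer $k \geq 1$ depending on $z$ (a zero of order $k-2$ of the quadratic differential $q$ if $k \geq 3$, a regular point if $k = 2$, a simple pole if $k = 1$). A saddle connection is a straight segment in $(S,q)$ with end points in $Z$ whose interior is embedded in $S \setminus Z$. A straight triangulation $\tau$ of $(S,q)$ is a triangulation of $S$ with vertex set $Z$ whose edges are saddle connections and whose faces are Euclidean triangles (the vertices of a triangle may coincide in $S$). It is veering if every edge has finite non-zero slope and, when edges of positive slope are coloured red and edges of negative slope blue, no triangle has all its edges of one colour and no vertex has all its incident edges of one colour. Let $\tau$ be a straight triangulation of $(S,q)$. Then $\tau$ is veering if and only if every edge $e$ of $\tau$ is a diagonal of an immersed rectangle, that is: there are a closed rectangle $R \subset \mathbb{C}$ of positive width and height with horizontal and vertical sides, and a continuous map $R \to S$ which maps the interior of $R$ to $S \setminus Z$, has the form $w \mapsto \pm w + c$ in the charts near every interior point of $R$, and maps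 a diagonal of $R$ onto $e$, at constant speed. -/

import Mathlib

open scoped Topology

/-- A half-translation surface structure on the space `S` (in use: compact, connected, Hausdorff)
with set of marked points `Z`. Away from `Z` it is an atlas of charts to `ℂ` whose transition maps
are locally `w ↦ ± w + c`; around a point of `Z` the structure has a cone point of angle `k * π`
with `k ≥ 1`, that is, there is a coordinate `ψ` in which the quadratic differential `dφ ^ 2` is
`(k ^ 2 / 4) ψ ^ (k - 2) dψ ^ 2` (a zero of order `k - 2` if `k ≥ 3`, a marked regular point if
`k = 2`, a simple pole if `k = 1`). -/
structure HalfTranslationSurface (S : Type*) [TopologicalSpace S] where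
  /-- The marked points; they include all zeroes and poles. -/
  Z : Set S
  finite_Z : Z.Finite
  nonempty_Z : Z.Nonempty
  /-- The flat charts. -/
  atlas : Set (OpenPartialHomeomorph S ℂ)
  source_subset : ∀ φ ∈ atlas, φ.source ⊆ Zᶜ
  exists_chart : ∀ x ∉ Z, ∃ φ ∈ atlas, x ∈ φ.source
  transition : ∀ φ ∈ atlas, ∀ φ' ∈ atlas, ∀ x ∈ φ.source ∩ φ'.source,
    ∃ ε c : ℂ, (ε = 1 ∨ ε = -1) ∧ ∀ᶠ y in 𝓝 x, φ' y = ε * φ y + c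
  cone_point : ∀ z ∈ Z, ∃ k : ℕ, 1 ≤ k ∧ ∃ ψ : OpenPartialHomeomorph S ℂ,
    z ∈ ψ.source ∧ ψ z = 0 ∧
      ∀ x ∈ ψ.source, x ≠ z → ∀ φ ∈ atlas, x ∈ φ.source →
        ∃ c : ℂ, ∀ᶠ y in 𝓝 x, (φ y - c) ^ 2 = ψ y ^ k

namespace HalfTranslationSurface

variable {S : Type*} [TopologicalSpace S]

/-- Near `w`, the map `f` from the plane takes values in the surface minus the marked points and
reads `u ↦ ± u + c` in a flat chart. In particular `f` is an immersion near `w`. -/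
def IsHalfTranslationAt (X : HalfTranslationSurface S) (f : ℂ → S) (w : ℂ) : Prop :=
  ∃ φ ∈ X.atlas, ∃ ε c : ℂ, (ε = 1 ∨ ε = -1) ∧
    ∀ᶠ u in 𝓝 w, f u ∈ φ.source ∧ φ (f u) = ε * u + c

/-- A saddle connection, parametrised by `[0, 1]` at constant speed: a straight segment with
end points marked and interior embedded in the complement of the marked points. -/
structure SaddleConnection (X : HalfTranslationSurface S) where
  /-- The parametrisation; only its values on `[0, 1]` matter. -/
  path : ℝ → S
  continuousOn : ContinuousOn path (Set.Icc 0 1)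
  path_zero : path 0 ∈ X.Z
  path_one : path 1 ∈ X.Z
  path_notMem : ∀ t ∈ Set.Ioo (0 : ℝ) 1, path t ∉ X.Z
  injOn : Set.InjOn path (Set.Ioo 0 1)
  /-- The integral of `√q` along the segment; it is determined up to sign. -/
  hol : ℂ
  hol_ne_zero : hol ≠ 0
  straight : ∀ t ∈ Set.Ioo (0 : ℝ) 1, ∃ φ ∈ X.atlas, ∃ ε : ℂ, (ε = 1 ∨ ε = -1) ∧
    ∀ᶠ s in 𝓝 t, path s ∈ φ.source ∧ φ (path s) = φ (path t) + ε * ((s - t : ℝ) : ℂ) * hol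

namespace SaddleConnection

variable {X : HalfTranslationSurface S}

/-- The interior of a saddle connection. -/
def inner (γ : X.SaddleConnection) : Set S := γ.path '' Set.Ioo 0 1

/-- The point `z` is an end point of `γ`. -/
def IsEndpoint (γ : X.SaddleConnection) (z : S) : Prop := γ.path 0 = z ∨ γ.path 1 = z

/-- The slope is finite and positive. -/
def HasPositiveSlope (γ : X.SaddleConnection) : Prop := γ.hol.re ≠ 0 ∧ 0 < γ.hol.im / γ.hol.re

/-- The slope is finite and negative. -/
def HasNegativeSlope (γ : X.SaddleConnection) : Prop := γ.hol.re ≠ 0 ∧ γ.hol.im / γ.hol.re < 0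

/-- The saddle connection `γ` is a diagonal of an immersed rectangle: there are a non-degenerate
closed rectangle in the plane with horizontal and vertical sides, with opposite corners `p` and `q`,
and a continuous map of it to the surface, which on the open rectangle is a half-translation
immersion into the complement of the marked points, and which takes the diagonal from `p` to `q`
to `γ`. -/
def IsDiagonalOfImmersedRectangle (γ : X.SaddleConnection) : Prop :=
  ∃ p q : ℂ, p.re ≠ q.re ∧ p.im ≠ q.im ∧ ∃ f : ℂ → S,
    ContinuousOn f (Set.uIcc p.re q.re ×ℂ Set.uIcc p.im q.im) ∧
    (∀ w ∈ interior (Set.uIcc p.re q.re ×ℂ Set.uIcc p.im q.im), X.IsHalfTranslationAt f w) ∧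
    ∀ t ∈ Set.Icc (0 : ℝ) 1, f (AffineMap.lineMap p q t) = γ.path t

end SaddleConnection

/-- A straight triangulation: a decomposition of the surface into the marked points (which are the
vertices), the interiors of finitely many saddle connections (the edges), and finitely many
open Euclidean triangles (the faces), the closed triangles being attached along their sides to the
edges. The vertices of one triangle may coincide in the surface. -/
structure StraightTriangulation (X : HalfTranslationSurface S) where
  Edge : Type
  Face : Type
  finite_edge : Finite Edge
  finite_face : Finite Face
  /-- The edges, as saddle connections. -/
  edge : Edge → X.SaddleConnection
  /-- The vertices in the plane of the Euclidean triangle that models a face. -/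
  vert : Face → Fin 3 → ℂ
  nondegenerate : ∀ T, AffineIndependent ℝ (vert T)
  /-- The map from the closed model triangle to the surface; its values elsewhere are irrelevant. -/
  faceMap : Face → ℂ → S
  continuousOn_faceMap : ∀ T, ContinuousOn (faceMap T) (convexHull ℝ (Set.range (vert T)))
  isHalfTranslationAt_faceMap : ∀ T, ∀ w ∈ interior (convexHull ℝ (Set.range (vert T))),
    X.IsHalfTranslationAt (faceMap T) w
  injOn_faceMap : ∀ T, Set.InjOn (faceMap T) (interior (convexHull ℝ (Set.range (vert T))))
  /-- The edge to which the side from vertex `i` to vertex `i + 1` (modulo 3) is attached. -/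
  side : Face → Fin 3 → Edge
  faceMap_side : ∀ T i,
    (∀ t ∈ Set.Icc (0 : ℝ) 1,
      faceMap T (AffineMap.lineMap (vert T i) (vert T (i + 1)) t) = (edge (side T i)).path t) ∨
    (∀ t ∈ Set.Icc (0 : ℝ) 1,
      faceMap T (AffineMap.lineMap (vert T i) (vert T (i + 1)) t) =
        (edge (side T i)).path (1 - t))
  disjoint_edges : ∀ e e', e ≠ e' → Disjoint (edge e).inner (edge e').inner
  disjoint_faces : ∀ T T', T ≠ T' →
    Disjoint (faceMap T '' interior (convexHull ℝ (Set.range (vert T))))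
      (faceMap T' '' interior (convexHull ℝ (Set.range (vert T'))))
  disjoint_edge_face : ∀ e T,
    Disjoint (edge e).inner (faceMap T '' interior (convexHull ℝ (Set.range (vert T))))
  cover : X.Z ∪ (⋃ e, (edge e).inner) ∪
    (⋃ T, faceMap T '' interior (convexHull ℝ (Set.range (vert T)))) = Set.univ

/-- The two colours of the edges of a coloured triangulation. -/
inductive Colour
  | red
  | blue

namespace StraightTriangulation

variable {X : HalfTranslationSurface S}

/-- A coloured triangulation is veering if it has no monochromatic triangles and no monochromatic
vertices. -/
def IsVeeringColouring (τ : X.StraightTriangulation) (col : τ.Edge → Colour) : Prop :=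
  (∀ T : τ.Face, ¬ ∃ c, ∀ i, col (τ.side T i) = c) ∧
    ∀ z ∈ X.Z, ¬ ∃ c, ∀ e : τ.Edge, (τ.edge e).IsEndpoint z → col e = c

/-- The colours of the edges match their slopes: red edges have positive slope, blue edges have
negative slope. In particular no edge is horizontal or vertical. -/
def MatchesSlopes (τ : X.StraightTriangulation) (col : τ.Edge → Colour) : Prop :=
  ∀ e : τ.Edge, (col e = Colour.red → (τ.edge e).HasPositiveSlope) ∧
    (col e = Colour.blue → (τ.edge e).HasNegativeSlope)

/-- A straight triangulation of a half-translation surface is veering if it carries a veering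
colouring that matches the slopes of the edges. -/
def IsVeering (τ : X.StraightTriangulation) : Prop :=
  ∃ col : τ.Edge → Colour, τ.MatchesSlopes col ∧ τ.IsVeeringColouring col

end StraightTriangulation

end HalfTranslationSurface

/-! Both directions develop faces into the plane and compare them with rectangles.

Suppose that no face has all its edges of one colour. After sign changes of the coordinates, a given
edge has positive slope. To immerse the half of its rectangle above the diagonal, develop the face
across the edge. Its two other sides do not both have positive slope. If neither does, the developed
triangle contains the rest of the half-rectangle. If one does, that side is a new front, closer to
the opposite corner, and the argument repeats with it. There are finitely many edges, so every front
advances by at least a fixed amount in one coordinate and the process stops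
(`exists_halfRectangle_of_developed`). The other half is obtained by symmetry, and the halves are
glued along the diagonal (`exists_rectangle`, `IsHalfTranslationOn.glue`).

Conversely, let every edge be a diagonal of an immersed rectangle. If the sides of a face had slopes
of one sign, the vertex with the middle real part would also have the middle imaginary part, so it
would lie inside the rectangle on the opposite side. The rectangle map and the face map agree by
unique continuation (`eqOn_faceMap`), so an interior point of the rectangle would go to a marked
point (`not_between_of_isDiagonal`). If all edges at a vertex had slopes of one sign, then every
face there would have a third side of the other sign, so every corner would stay in a closed
quadrant of the first sign. A cone angle of at least `π` leaves directions uncovered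
(`not_monochromatic_vertex`). -/

namespace HalfTranslationSurface

variable {S : Type*} [TopologicalSpace S] {X : HalfTranslationSurface S}

/-! ### Half-translation maps from the plane -/

/-- Two complex affine functions that agree at two points are equal. -/
lemma affine_eq_of_eq_of_eq {ε c ε' c' u v : ℂ} (huv : u ≠ v) (hu : ε * u + c = ε' * u + c')
    (hv : ε * v + c = ε' * v + c') : ε = ε' ∧ c = c' := by
  have h : (ε - ε') * (u - v) = 0 := by linear_combination hu - hv
  rcases mul_eq_zero.mp h with h | h
  · have : ε = ε' := sub_eq_zero.mp h
    subst this
    exact ⟨rfl, by linear_combination hu⟩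
  · exact absurd (sub_eq_zero.mp h) huv

lemma mul_self_eq_one_of_sign {ε : ℂ} (h : ε = 1 ∨ ε = -1) : ε * ε = 1 := by
  rcases h with rfl | rfl <;> norm_num

lemma sign_mul {ε ε' : ℂ} (h : ε = 1 ∨ ε = -1) (h' : ε' = 1 ∨ ε' = -1) :
    ε * ε' = 1 ∨ ε * ε' = -1 := by
  rcases h with rfl | rfl <;> rcases h' with rfl | rfl <;> simp

lemma sign_ne_zero {ε : ℂ} (h : ε = 1 ∨ ε = -1) : ε ≠ 0 := by
  rcases h with rfl | rfl <;> norm_num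

namespace IsHalfTranslationAt

variable {f g : ℂ → S} {w : ℂ}

lemma notMem (h : X.IsHalfTranslationAt f w) : f w ∉ X.Z := by
  obtain ⟨φ, hφ, ε, c, -, hev⟩ := h
  exact X.source_subset φ hφ hev.self_of_nhds.1

lemma continuousAt (h : X.IsHalfTranslationAt f w) : ContinuousAt f w := by
  obtain ⟨φ, hφ, ε, c, -, hev⟩ := h
  have h1 := hev.self_of_nhds
  have h2 : ContinuousAt (fun u : ℂ => φ.symm (ε * u + c)) w := by
    apply ContinuousAt.comp (g := φ.symm)
    · rw [← h1.2]
      exact φ.symm.continuousAt (φ.map_source h1.1)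
    · fun_prop
  refine h2.congr ?_
  filter_upwards [hev] with u hu
  rw [← hu.2, φ.left_inv hu.1]

lemma congr (h : X.IsHalfTranslationAt f w) (hfg : f =ᶠ[𝓝 w] g) : X.IsHalfTranslationAt g w := by
  obtain ⟨φ, hφ, ε, c, hε, hev⟩ := h
  refine ⟨φ, hφ, ε, c, hε, ?_⟩
  filter_upwards [hev, hfg] with u hu hu'
  rwa [← hu']

lemma comp_affine {ε c : ℂ} (hε : ε = 1 ∨ ε = -1) (h : X.IsHalfTranslationAt f (ε * w + c)) :
    X.IsHalfTranslationAt (fun u => f (ε * u + c)) w := by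
  obtain ⟨φ, hφ, ε', c', hε', hev⟩ := h
  refine ⟨φ, hφ, ε' * ε, ε' * c + c', sign_mul hε' hε, ?_⟩
  have : Filter.Tendsto (fun u : ℂ => ε * u + c) (𝓝 w) (𝓝 (ε * w + c)) :=
    Continuous.tendsto (by fun_prop) w
  filter_upwards [this.eventually hev] with u hu
  refine ⟨hu.1, hu.2.trans (by ring)⟩

/-- The definition supplies some chart; a transition map replaces it by any prescribed chart at `f
w`. -/
lemma eventually_chart_eq (h : X.IsHalfTranslationAt f w) {φ : OpenPartialHomeomorph S ℂ}
    (hφ : φ ∈ X.atlas) (hw : f w ∈ φ.source) :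
    ∃ ε c : ℂ, (ε = 1 ∨ ε = -1) ∧ ∀ᶠ u in 𝓝 w, φ (f u) = ε * u + c := by
  have hc := h.continuousAt
  obtain ⟨φ', hφ', ε', c', hε', hev⟩ := h
  obtain ⟨ε, c, hε, htr⟩ := X.transition φ' hφ' φ hφ (f w) ⟨hev.self_of_nhds.1, hw⟩
  refine ⟨ε * ε', ε * c' + c, sign_mul hε hε', ?_⟩
  filter_upwards [hev, hc.eventually htr] with u hu hu'
  rw [hu', hu.2]
  ring

end IsHalfTranslationAt

/-- A continuous map of a region of the plane to the surface that is a half-translation immersion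
into the complement of the marked points on the interior. -/
def IsHalfTranslationOn (X : HalfTranslationSurface S) (f : ℂ → S) (K : Set ℂ) : Prop :=
  ContinuousOn f K ∧ ∀ w ∈ interior K, X.IsHalfTranslationAt f w

namespace IsHalfTranslationOn

variable {f g : ℂ → S} {K L : Set ℂ} {w : ℂ}

lemma mono (h : X.IsHalfTranslationOn f K) (hL : L ⊆ K) : X.IsHalfTranslationOn f L :=
  ⟨h.1.mono hL, fun w hw => h.2 w (interior_mono hL hw)⟩

lemma congr (h : X.IsHalfTranslationOn f K) (hfg : Set.EqOn f g K) :
    X.IsHalfTranslationOn g K := by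
  refine ⟨h.1.congr hfg.symm, fun w hw => (h.2 w hw).congr ?_⟩
  filter_upwards [mem_interior_iff_mem_nhds.mp hw] with u hu using hfg hu

lemma comp_affine {ε c : ℂ} (hε : ε = 1 ∨ ε = -1) (h : X.IsHalfTranslationOn f K) :
    X.IsHalfTranslationOn (fun u => f (ε * u + c)) ((fun u => ε * u + c) ⁻¹' K) := by
  have hcont : Continuous (fun u : ℂ => ε * u + c) := by fun_prop
  refine ⟨h.1.comp hcont.continuousOn (fun u hu => hu), fun w hw => ?_⟩
  refine IsHalfTranslationAt.comp_affine hε (h.2 _ ?_)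
  have hopen : IsOpenMap (fun u : ℂ => ε * u + c) :=
    ((Homeomorph.mulLeft₀ ε (sign_ne_zero hε)).trans (Homeomorph.addRight c)).isOpenMap
  rw [hopen.preimage_interior_eq_interior_preimage hcont K |>.symm] at hw
  exact hw

end IsHalfTranslationOn

/-! ### Unique continuation up to the boundary, and gluing -/

/-- The identity theorem on the intersection of a convex set with a ball, including boundary
points. -/
lemma eqOn_inter_ball_of_eventuallyEq {K : Set ℂ} (hK : Convex ℝ K) (hne : (interior K).Nonempty)
    {w u : ℂ} {r : ℝ} {F G : ℂ → ℂ} (hFc : ContinuousOn F (K ∩ Metric.ball w r))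
    (hF : ∀ v ∈ interior K ∩ Metric.ball w r, AnalyticAt ℂ F v) (hG : ∀ v, AnalyticAt ℂ G v)
    (hu : u ∈ interior K ∩ Metric.ball w r) (hFG : F =ᶠ[𝓝 u] G) :
    Set.EqOn F G (K ∩ Metric.ball w r) := by
  have h1 : Set.EqOn F G (interior K ∩ Metric.ball w r) :=
    AnalyticOnNhd.eqOn_of_preconnected_of_eventuallyEq hF (fun v _ => hG v)
      (hK.interior.inter (convex_ball w r)).isPreconnected hu hFG
  -- Boundary points follow by continuity: a convex set with non-empty interior lies in the closure
  -- of that interior.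
  refine h1.of_subset_closure hFc (fun v _ => (hG v).continuousAt.continuousWithinAt)
    (Set.inter_subset_inter_left _ interior_subset) ?_
  have h2 : K ⊆ closure (interior K) := by
    rw [hK.closure_interior_eq_closure_of_nonempty_interior hne]
    exact subset_closure
  intro v hv
  rw [Set.inter_comm]
  exact Metric.isOpen_ball.inter_closure ⟨hv.2, h2 hv.1⟩

lemma nonempty_interior_inter_ball {K : Set ℂ} (hK : Convex ℝ K) (hne : (interior K).Nonempty)
    {w : ℂ} (hw : w ∈ K) {r : ℝ} (hr : 0 < r) : (interior K ∩ Metric.ball w r).Nonempty := by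
  have h2 : K ⊆ closure (interior K) := by
    rw [hK.closure_interior_eq_closure_of_nonempty_interior hne]
    exact subset_closure
  exact (mem_closure_iff.mp (h2 hw) _ Metric.isOpen_ball (Metric.mem_ball_self hr)).imp
    fun v hv => ⟨hv.2, hv.1⟩

/-- Near a point of the closed convex region, which may lie on its boundary, a half-translation map
reads `v ↦ ± v + c` in a chart. -/
lemma IsHalfTranslationOn.eventually_chart_eq {K : Set ℂ} {g : ℂ → S}
    (hg : X.IsHalfTranslationOn g K) (hK : Convex ℝ K) (hne : (interior K).Nonempty) {w : ℂ}
    (hw : w ∈ K) {φ : OpenPartialHomeomorph S ℂ} (hφ : φ ∈ X.atlas) (hwφ : g w ∈ φ.source) :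
    ∃ ε c : ℂ, (ε = 1 ∨ ε = -1) ∧ ∀ᶠ v in 𝓝[K] w, g v ∈ φ.source ∧ φ (g v) = ε * v + c := by
  have h1 : ∀ᶠ v in 𝓝[K] w, g v ∈ φ.source := (hg.1 w hw).eventually (φ.open_source.mem_nhds hwφ)
  obtain ⟨r, hr, hball⟩ := Metric.mem_nhdsWithin_iff.mp h1
  rw [Set.inter_comm] at hball
  obtain ⟨u, hu⟩ := nonempty_interior_inter_ball hK hne hw hr
  have hloc : ∀ v ∈ interior K ∩ Metric.ball w r, ∃ ε c : ℂ, (ε = 1 ∨ ε = -1) ∧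
      ∀ᶠ u in 𝓝 v, φ (g u) = ε * u + c := fun v hv =>
    (hg.2 v hv.1).eventually_chart_eq hφ (hball ⟨interior_subset hv.1, hv.2⟩)
  obtain ⟨ε, c, hε, hev⟩ := hloc u hu
  refine ⟨ε, c, hε, ?_⟩
  -- A priori the sign and the constant depend on the point; the identity theorem propagates those
  -- found at `u`.
  have key : Set.EqOn (fun v => φ (g v)) (fun v => ε * v + c) (K ∩ Metric.ball w r) := by
    refine eqOn_inter_ball_of_eventuallyEq hK hne ?_ ?_ (fun v => by fun_prop) hu hev
    · exact φ.continuousOn.comp (hg.1.mono Set.inter_subset_left) hball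
    · intro v hv
      obtain ⟨ε', c', -, hev'⟩ := hloc v hv
      have : AnalyticAt ℂ (fun u => ε' * u + c') v := by fun_prop
      exact this.congr (Filter.EventuallyEq.symm hev')
  filter_upwards [h1, inter_mem_nhdsWithin K (Metric.ball_mem_nhds w hr)] with v hv hv'
    using ⟨hv, key hv'⟩

/-- Near a point that goes to a marked point, a half-translation map is given by
`ψ ^ k = (u - w) ^ 2` in the coordinate `ψ` at the cone point. -/
lemma IsHalfTranslationOn.eventually_cone_eq {K : Set ℂ} {g : ℂ → S}
    (hg : X.IsHalfTranslationOn g K) (hK : Convex ℝ K) (hne : (interior K).Nonempty) {w : ℂ}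
    (hw : w ∈ K) (hwZ : g w ∈ X.Z) {k : ℕ} (hk : 1 ≤ k) {ψ : OpenPartialHomeomorph S ℂ}
    (hwψ : g w ∈ ψ.source) (hψ0 : ψ (g w) = 0)
    (hψ : ∀ x ∈ ψ.source, x ≠ g w → ∀ φ ∈ X.atlas, x ∈ φ.source →
        ∃ c : ℂ, ∀ᶠ y in 𝓝 x, (φ y - c) ^ 2 = ψ y ^ k) :
    ∀ᶠ v in 𝓝[K] w, ψ (g v) ^ k = (v - w) ^ 2 := by
  have h1 : ∀ᶠ v in 𝓝[K] w, g v ∈ ψ.source := (hg.1 w hw).eventually (ψ.open_source.mem_nhds hwψ)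
  obtain ⟨r, hr, hball⟩ := Metric.mem_nhdsWithin_iff.mp h1
  rw [Set.inter_comm] at hball
  obtain ⟨u, hu⟩ := nonempty_interior_inter_ball hK hne hw hr
  have hloc : ∀ v ∈ interior K ∩ Metric.ball w r, ∃ ε c : ℂ, (ε = 1 ∨ ε = -1) ∧
      ∀ᶠ u in 𝓝 v, ψ (g u) ^ k = (ε * u + c) ^ 2 := by
    intro v hv
    have hvT := hg.2 v hv.1
    have hvZ := hvT.notMem
    have hcont := hvT.continuousAt
    obtain ⟨φ, hφ, ε, c, hε, hev⟩ := hvT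
    obtain ⟨c', hc'⟩ := hψ (g v) (hball ⟨interior_subset hv.1, hv.2⟩)
      (fun h => hvZ (h ▸ hwZ)) φ hφ hev.self_of_nhds.1
    refine ⟨ε, c - c', hε, ?_⟩
    filter_upwards [hev, hcont.eventually hc'] with u hu hu'
    rw [← hu', hu.2]
    ring
  obtain ⟨ε, c, hε, hev⟩ := hloc u hu
  have key : Set.EqOn (fun v => ψ (g v) ^ k) (fun v => (ε * v + c) ^ 2) (K ∩ Metric.ball w r) := by
    refine eqOn_inter_ball_of_eventuallyEq hK hne ?_ ?_ (fun v => by fun_prop) hu hev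
    · exact (ψ.continuousOn.comp (hg.1.mono Set.inter_subset_left) hball).pow k
    · intro v hv
      obtain ⟨ε', c', -, hev'⟩ := hloc v hv
      have : AnalyticAt ℂ (fun u => (ε' * u + c') ^ 2) v := by fun_prop
      exact this.congr (Filter.EventuallyEq.symm hev')
  -- Evaluation at `w`, where `ψ` vanishes and `0 ^ k = 0` because `k ≥ 1`, determines the constant.
  have h0 : ε * w + c = 0 := by
    have := key ⟨hw, Metric.mem_ball_self hr⟩
    simp only [hψ0] at this
    rw [zero_pow (by omega)] at this
    exact pow_eq_zero_iff (two_ne_zero) |>.mp this.symm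
  filter_upwards [inter_mem_nhdsWithin K (Metric.ball_mem_nhds w hr)] with v hv'
  have h2 := key hv'
  simp only at h2
  rw [h2]
  have h3 := mul_self_eq_one_of_sign hε
  have h4 : ε * v + c = ε * (v - w) := by linear_combination h0
  rw [h4]
  linear_combination (v - w) ^ 2 * h3

/-- Half-translation maps of the two sides of a line that agree on the line fit together. -/
lemma IsHalfTranslationOn.glue {K : Set ℂ} {l : ℂ →L[ℝ] ℝ} (hl : l ≠ 0) {b : ℝ} {g₁ g₂ : ℂ → S}
    (h₁ : X.IsHalfTranslationOn g₁ (K ∩ {w | l w ≤ b}))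
    (h₂ : X.IsHalfTranslationOn g₂ (K ∩ {w | b ≤ l w}))
    (heq : ∀ w ∈ K, l w = b → g₁ w = g₂ w)
    (hZ : ∀ w ∈ interior K, l w = b → g₁ w ∉ X.Z) :
    ∃ g : ℂ → S, X.IsHalfTranslationOn g K ∧ (∀ w ∈ K, l w ≤ b → g w = g₁ w) ∧
      ∀ w ∈ K, b ≤ l w → g w = g₂ w := by
  classical
  have hcl : IsClosed {w | l w ≤ b} := isClosed_le l.continuous continuous_const
  have hcl' : IsClosed {w | b ≤ l w} := isClosed_le continuous_const l.continuous
  set g : ℂ → S := fun w => if l w ≤ b then g₁ w else g₂ w with hgdef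
  have hg1 : ∀ w ∈ K, l w ≤ b → g w = g₁ w := fun w _ hw => by simp [hgdef, hw]
  have hg2 : ∀ w ∈ K, b ≤ l w → g w = g₂ w := fun w hwK hw => by
    rcases hw.lt_or_eq with h | h
    · simp [hgdef, not_le.mpr h]
    · rw [hg1 w hwK h.symm.le, heq w hwK h.symm]
  have e1 : X.IsHalfTranslationOn g (K ∩ {w | l w ≤ b}) :=
    h₁.congr fun w hw => (hg1 w hw.1 hw.2).symm
  have e2 : X.IsHalfTranslationOn g (K ∩ {w | b ≤ l w}) :=
    h₂.congr fun w hw => (hg2 w hw.1 hw.2).symm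
  refine ⟨g, ⟨?_, ?_⟩, hg1, hg2⟩
  · intro w hw
    have hKu : K = (K ∩ {w | l w ≤ b}) ∪ (K ∩ {w | b ≤ l w}) := by
      ext v
      simp only [Set.mem_union, Set.mem_inter_iff, Set.mem_ofPred_eq]
      have := le_total (l v) b
      tauto
    have k1 : ContinuousWithinAt g (K ∩ {w | l w ≤ b}) w := by
      by_cases h : l w ≤ b
      · exact e1.1 w ⟨hw, h⟩
      · apply continuousWithinAt_of_notMem_closure
        exact fun hmem => h (hcl.closure_subset_iff.mpr Set.inter_subset_right hmem)
    have k2 : ContinuousWithinAt g (K ∩ {w | b ≤ l w}) w := by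
      by_cases h : b ≤ l w
      · exact e2.1 w ⟨hw, h⟩
      · apply continuousWithinAt_of_notMem_closure
        exact fun hmem => h (hcl'.closure_subset_iff.mpr Set.inter_subset_right hmem)
    rw [hKu]
    exact k1.union k2
  · intro w hw
    rcases lt_trichotomy (l w) b with h | h | h
    · apply e1.2 w
      rw [interior_inter]
      refine ⟨hw, mem_interior_iff_mem_nhds.mpr ?_⟩
      filter_upwards [l.continuous.continuousAt.eventually_lt_const h] with v hv using hv.le
    -- On the line the image is unmarked, so it has a chart. In that chart each side reads as an
    -- affine function, and it remains to see that the two are the same.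
    · have hwK := interior_subset hw
      obtain ⟨φ, hφ, hwφ⟩ := X.exists_chart (g w) (by rw [hg1 w hwK h.le]; exact hZ w hw h)
      obtain ⟨r, hr, hball⟩ := Metric.mem_nhds_iff.mp (mem_interior_iff_mem_nhds.mp hw)
      obtain ⟨N, hN⟩ : ∃ N, l N = 1 := by
        obtain ⟨v, hv⟩ : ∃ v, l v ≠ 0 := by
          by_contra! hcon
          exact hl (ContinuousLinearMap.ext hcon)
        exact ⟨(l v)⁻¹ • v, by rw [map_smul, smul_eq_mul, inv_mul_cancel₀ hv]⟩
      have hside : ∀ s : ℝ, ∃ t : ℝ, 0 < t ∧ w + (t * s) • N ∈ Metric.ball w r := by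
        intro s
        have : Filter.Tendsto (fun t : ℝ => w + (t * s) • N) (𝓝[>] 0) (𝓝 (w + ((0 : ℝ) * s) • N)) :=
          ((Continuous.tendsto (by fun_prop) (0 : ℝ))).mono_left nhdsWithin_le_nhds
        rw [zero_mul, zero_smul, add_zero] at this
        obtain ⟨t, ht, ht'⟩ := ((this.eventually (Metric.ball_mem_nhds w hr)).and
          self_mem_nhdsWithin).exists
        exact ⟨t, ht', ht⟩
      have n1 : (interior (Metric.ball w r ∩ {w | l w ≤ b})).Nonempty := by
        obtain ⟨t, ht, hmem⟩ := hside (-1)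
        refine ⟨_, mem_interior_iff_mem_nhds.mpr
          (Filter.inter_mem (Metric.isOpen_ball.mem_nhds hmem) ?_)⟩
        have : l (w + (t * -1) • N) < b := by
          rw [map_add, map_smul, hN, h, smul_eq_mul]
          linarith
        filter_upwards [l.continuous.continuousAt.eventually_lt_const this] with v hv using hv.le
      have n2 : (interior (Metric.ball w r ∩ {w | b ≤ l w})).Nonempty := by
        obtain ⟨t, ht, hmem⟩ := hside 1
        refine ⟨_, mem_interior_iff_mem_nhds.mpr
          (Filter.inter_mem (Metric.isOpen_ball.mem_nhds hmem) ?_)⟩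
        have : b < l (w + (t * 1) • N) := by
          rw [map_add, map_smul, hN, h, smul_eq_mul]
          linarith
        filter_upwards [l.continuous.continuousAt.eventually_const_lt this] with v hv using hv.le
      have hlin : IsLinearMap ℝ l := ⟨l.map_add, l.map_smul⟩
      obtain ⟨ε₁, c₁, hε₁, ev₁⟩ := (e1.mono (Set.inter_subset_inter_left _ hball)).eventually_chart_eq
        ((convex_ball w r).inter (convex_halfSpace_le hlin b)) n1
        ⟨Metric.mem_ball_self hr, h.le⟩ hφ hwφ
      obtain ⟨ε₂, c₂, hε₂, ev₂⟩ := (e2.mono (Set.inter_subset_inter_left _ hball)).eventually_chart_eq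
        ((convex_ball w r).inter (convex_halfSpace_ge hlin b)) n2
        ⟨Metric.mem_ball_self hr, h.ge⟩ hφ hwφ
      rw [nhdsWithin_inter_of_mem (mem_nhdsWithin_of_mem_nhds
        (Metric.ball_mem_nhds w hr))] at ev₁ ev₂
      rw [eventually_nhdsWithin_iff] at ev₁ ev₂
      -- `D` points along the line, and the two affine functions agree at `w` and at a nearby `w + t
      -- • D`.
      obtain ⟨D, hD0, hD⟩ : ∃ D : ℂ, D ≠ 0 ∧ l D = 0 := by
        by_cases h1 : l 1 = 0
        · exact ⟨1, one_ne_zero, h1⟩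
        · refine ⟨(l 1) • Complex.I - (l Complex.I) • (1 : ℂ), ?_, ?_⟩
          · intro h0
            have := congrArg Complex.im h0
            simp at this
            exact h1 this
          · rw [map_sub, map_smul, map_smul, smul_eq_mul, smul_eq_mul]
            ring
      have hagree : ε₁ = ε₂ ∧ c₁ = c₂ := by
        have ht : Filter.Tendsto (fun t : ℝ => w + t • D) (𝓝[>] 0) (𝓝 w) := by
          have : Filter.Tendsto (fun t : ℝ => w + t • D) (𝓝 0) (𝓝 (w + (0 : ℝ) • D)) :=
            Continuous.tendsto (by fun_prop) _
          rw [zero_smul, add_zero] at this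
          exact this.mono_left nhdsWithin_le_nhds
        obtain ⟨t, ⟨ht1, ht2⟩, ht3⟩ := (((ht.eventually ev₁).and (ht.eventually ev₂)).and
          self_mem_nhdsWithin).exists
        have hlt : l (w + t • D) = b := by rw [map_add, map_smul, hD, h, smul_zero, add_zero]
        have a1 := (ht1 hlt.le).2
        have a2 := (ht2 hlt.ge).2
        have b1 := (ev₁.self_of_nhds h.le).2
        have b2 := (ev₂.self_of_nhds h.ge).2
        refine affine_eq_of_eq_of_eq (u := w) (v := w + t • D) ?_ (b1.symm.trans b2)
          (a1.symm.trans a2)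
        intro hc
        have : t • D = 0 := by linear_combination -hc
        rcases smul_eq_zero.mp this with h0 | h0
        · exact (ne_of_gt ht3) h0
        · exact hD0 h0
      refine ⟨φ, hφ, ε₁, c₁, hε₁, ?_⟩
      filter_upwards [ev₁, ev₂] with v hv1 hv2
      rcases le_total (l v) b with hv | hv
      · exact hv1 hv
      · rw [hagree.1, hagree.2]
        exact hv2 hv
    · apply e2.2 w
      rw [interior_inter]
      refine ⟨hw, mem_interior_iff_mem_nhds.mpr ?_⟩
      filter_upwards [l.continuous.continuousAt.eventually_const_lt h] with v hv using hv.le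

/-! ### Holonomy of segments, and unique continuation in the surface -/

/-- A half-translation map that takes a segment to a saddle connection: comparison of the
directions in a chart at the midpoint. -/
lemma mul_sub_eq_mul_hol {K : Set ℂ} {g : ℂ → S} {γ : X.SaddleConnection}
    {φ : OpenPartialHomeomorph S ℂ} {ε ε' c a b : ℂ} (hK : Convex ℝ K) (ha : a ∈ K) (hb : b ∈ K)
    (hγ : ∀ t ∈ Set.Icc (0 : ℝ) 1, g (AffineMap.lineMap a b t) = γ.path t)
    (hev : ∀ᶠ s in 𝓝 (1 / 2 : ℝ), φ (γ.path s) =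
      φ (γ.path (1 / 2)) + ε * ((s - 1 / 2 : ℝ) : ℂ) * γ.hol)
    (hev' : ∀ᶠ v in 𝓝[K] (AffineMap.lineMap a b (1 / 2 : ℝ)), φ (g v) = ε' * v + c) :
    ε' * (b - a) = ε * γ.hol := by
  have hm := hγ (1 / 2) (by norm_num)
  have hmem : ∀ t ∈ Set.Icc (0 : ℝ) 1, AffineMap.lineMap a b t ∈ K := fun t ht =>
    hK.lineMap_mem ha hb ht
  have ht : Filter.Tendsto (fun t : ℝ => AffineMap.lineMap a b t) (𝓝[>] (1 / 2))
      (𝓝[K] (AffineMap.lineMap a b (1 / 2 : ℝ))) := by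
    refine tendsto_nhdsWithin_iff.mpr ⟨?_, ?_⟩
    · exact (Continuous.tendsto (AffineMap.lineMap_continuous) _).mono_left nhdsWithin_le_nhds
    · filter_upwards [Ioo_mem_nhdsGT (show (1 / 2 : ℝ) < 1 by norm_num)] with t ht
      exact hmem t ⟨by linarith [ht.1], ht.2.le⟩
  obtain ⟨t, ⟨⟨h1, h2⟩, h3⟩⟩ := (((ht.eventually hev').and (hev.filter_mono nhdsWithin_le_nhds)).and
    (Ioo_mem_nhdsGT (show (1 / 2 : ℝ) < 1 by norm_num))).exists
  have h0 := hev'.self_of_nhdsWithin (hmem (1 / 2) (by norm_num))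
  rw [hm] at h0
  rw [hγ t ⟨by linarith [h3.1], h3.2.le⟩, h2, h0] at h1
  rw [AffineMap.lineMap_apply, AffineMap.lineMap_apply] at h1
  simp only [vsub_eq_sub, Complex.real_smul, vadd_eq_add] at h1
  have h4 : ((t - 1 / 2 : ℝ) : ℂ) ≠ 0 := by
    have := h3.1
    exact_mod_cast (by linarith : t - 1 / 2 > 0).ne'
  have h5 : ((t - 1 / 2 : ℝ) : ℂ) * (ε' * (b - a) - ε * γ.hol) = 0 := by
    push_cast at h1 ⊢
    linear_combination -h1
  exact sub_eq_zero.mp ((mul_eq_zero.mp h5).resolve_left h4)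

/-- A half-translation map that takes a segment to a saddle connection preserves holonomy up to
sign. -/
lemma IsHalfTranslationOn.sub_eq_hol {K : Set ℂ} {g : ℂ → S}
    (hg : X.IsHalfTranslationOn g K) (hK : Convex ℝ K) (hne : (interior K).Nonempty) {a b : ℂ}
    (ha : a ∈ K) (hb : b ∈ K) (γ : X.SaddleConnection)
    (hγ : ∀ t ∈ Set.Icc (0 : ℝ) 1, g (AffineMap.lineMap a b t) = γ.path t) :
    b - a = γ.hol ∨ b - a = -γ.hol := by
  obtain ⟨φ, hφ, ε, hε, hev⟩ := γ.straight (1 / 2) (by norm_num)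
  obtain ⟨ε', c, hε', hev'⟩ := hg.eventually_chart_eq hK hne
    (hK.lineMap_mem ha hb (by norm_num : (1 / 2 : ℝ) ∈ Set.Icc (0 : ℝ) 1)) hφ
    (by rw [hγ (1 / 2) (by norm_num)]; exact hev.self_of_nhds.1)
  have h6 := mul_sub_eq_mul_hol hK ha hb hγ (hev.mono fun s hs => hs.2) (hev'.mono fun s hs => hs.2)
  rcases hε with rfl | rfl <;> rcases hε' with rfl | rfl
  · left; linear_combination h6
  · right; linear_combination -h6
  · right; linear_combination h6
  · left; linear_combination -h6

/-- Half-translation maps that agree near one point of a connected open set agree on it. -/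
lemma eqOn_of_eventuallyEq [T2Space S] {U : Set ℂ} (hU : IsPreconnected U) {f g : ℂ → S}
    (hf : ∀ w ∈ U, X.IsHalfTranslationAt f w) (hg : ∀ w ∈ U, X.IsHalfTranslationAt g w) {u : ℂ}
    (hu : u ∈ U) (hfg : f =ᶠ[𝓝 u] g) : Set.EqOn f g U := by
  have hsub : U ⊆ {w | f =ᶠ[𝓝 w] g} := by
    refine hU.subset_of_closure_inter_subset isOpen_setOfPred_eventually_nhds ⟨u, hu, hfg⟩ ?_
    rintro w ⟨hw, hwU⟩
    have hfc := (hf w hwU).continuousAt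
    have hgc := (hg w hwU).continuousAt
    have hfr : ∃ᶠ v in 𝓝 w, f =ᶠ[𝓝 v] g := mem_closure_iff_frequently.mp hw
    -- The set where the germs agree is open. For closedness, the Hausdorff property gives equal
    -- values at a limit point, hence a common chart.
    have hval : f w = g w := by
      by_contra hne
      obtain ⟨A, B, hA, hB, hwA, hwB, hAB⟩ := t2_separation hne
      obtain ⟨v, hv, hv1, hv2⟩ := (hfr.and_eventually ((hfc.eventually (hA.mem_nhds hwA)).and
        (hgc.eventually (hB.mem_nhds hwB)))).exists
      exact Set.disjoint_left.mp hAB hv1 (hv.self_of_nhds ▸ hv2)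
    obtain ⟨φ, hφ, hwφ⟩ := X.exists_chart (f w) (hf w hwU).notMem
    obtain ⟨ε, c, -, hev⟩ := (hf w hwU).eventually_chart_eq hφ hwφ
    obtain ⟨ε', c', -, hev'⟩ := (hg w hwU).eventually_chart_eq hφ (hval ▸ hwφ)
    obtain ⟨v, hv, hv1, hv2⟩ := (hfr.and_eventually
      (hev.eventually_nhds.and hev'.eventually_nhds)).exists
    have h3 : ∀ᶠ x in 𝓝 v, ε * x + c = ε' * x + c' := by
      filter_upwards [hv, hv1, hv2] with x h1 h2 h3
      rw [← h2, ← h3, h1]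
    obtain ⟨x, hx, hxv⟩ := ((h3.filter_mono nhdsWithin_le_nhds).and
      (self_mem_nhdsWithin : ∀ᶠ x in 𝓝[≠] v, x ∈ ({v}ᶜ : Set ℂ))).exists
    obtain ⟨rfl, rfl⟩ := affine_eq_of_eq_of_eq hxv hx h3.self_of_nhds
    filter_upwards [hev, hev', hfc.eventually (φ.open_source.mem_nhds hwφ),
      hgc.eventually (φ.open_source.mem_nhds (hval ▸ hwφ))] with y h1 h2 h3 h4
    exact φ.injOn h3 h4 (h1.trans h2.symm)
  exact fun w hw => (hsub hw).self_of_nhds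

/-! ### Triangles in the plane and images of compact sets -/

/-- Barycentric coordinates of a triangle in the plane. -/
lemma exists_barycentric {v : Fin 3 → ℂ} (hv : AffineIndependent ℝ v) :
    ∃ β : Fin 3 → ℂ → ℝ, (∀ w, ∑ i, β i w = 1) ∧ (∀ w, ∑ i, β i w • v i = w) ∧
      convexHull ℝ (Set.range v) = {w | ∀ i, 0 ≤ β i w} ∧
      interior (convexHull ℝ (Set.range v)) = {w | ∀ i, 0 < β i w} := by
  have htop : affineSpan ℝ (Set.range v) = ⊤ := by
    rw [hv.affineSpan_eq_top_iff_card_eq_finrank_add_one]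
    simp [Complex.finrank_real_complex]
  let b : AffineBasis (Fin 3) ℝ ℂ := ⟨v, hv, htop⟩
  refine ⟨fun i w => b.coord i w, b.sum_coord_apply_eq_one, fun w =>
    b.linear_combination_coord_eq_self w, ?_, b.interior_convexHull⟩
  exact b.convexHull_eq_nonneg_coord

lemma fin_three_eq (i j : Fin 3) : i = j ∨ i = j + 1 ∨ i = j + 2 := by
  revert i j; decide

lemma fin_three_sum {M : Type*} [AddCommMonoid M] (f : Fin 3 → M) (j : Fin 3) :
    ∑ i, f i = f j + f (j + 1) + f (j + 2) := by
  rw [Fin.sum_univ_three]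
  fin_cases j
  · rfl
  · change f 0 + f 1 + f 2 = f 1 + f 2 + f 0
    abel
  · change f 0 + f 1 + f 2 = f 2 + f 0 + f 1
    abel

/-- A point of a closed triangle that is not in the interior lies on a side. -/
lemma exists_side_of_notMem_interior {v : Fin 3 → ℂ} (hv : AffineIndependent ℝ v) {w : ℂ}
    (hw : w ∈ convexHull ℝ (Set.range v)) (hw' : w ∉ interior (convexHull ℝ (Set.range v))) :
    ∃ i, ∃ t ∈ Set.Icc (0 : ℝ) 1, w = AffineMap.lineMap (v i) (v (i + 1)) t := by
  obtain ⟨β, h1, h2, h3, h4⟩ := exists_barycentric hv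
  rw [h3] at hw
  rw [h4] at hw'
  simp only [Set.mem_ofPred_eq, not_forall, not_lt] at hw hw'
  obtain ⟨j, hj⟩ := hw'
  have hj0 := le_antisymm hj (hw j)
  have e1 := h1 w
  have e2 := h2 w
  rw [fin_three_sum _ j] at e1 e2
  rw [hj0] at e1 e2
  -- The side opposite vertex `j` runs from `j + 1` to `j + 2`, and `β (j + 2)` is its parameter.
  refine ⟨j + 1, β (j + 2) w, ⟨hw _, by linarith [hw (j + 1)]⟩, ?_⟩
  have : j + 1 + 1 = j + 2 := by rw [add_assoc]; rfl
  rw [this, AffineMap.lineMap_apply]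
  refine e2.symm.trans ?_
  have e3 : ((β (j + 1) w : ℝ) : ℂ) = 1 - β (j + 2) w := by
    rw [← Complex.ofReal_one, ← Complex.ofReal_sub]
    congr 1
    linarith
  simp only [vsub_eq_sub, Complex.real_smul, vadd_eq_add, e3]
  push_cast
  ring

/-- A property that holds near all preimages of `x` in a compact set holds near `x` on the
image. -/
lemma eventually_of_isCompact [T2Space S] {Y : Type*} [TopologicalSpace Y] {K : Set Y}
    (hK : IsCompact K) {g : Y → S} (hg : ContinuousOn g K) {x : S} {P : S → Prop}
    (h : ∀ w ∈ K, g w = x → ∀ᶠ u in 𝓝[K] w, P (g u)) :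
    ∀ᶠ y in 𝓝 x, y ∈ g '' K → P y := by
  by_contra hcon
  -- If the claim fails, the bad points of `K` whose images approach `x` have a cluster point in
  -- `K`; its image is `x`, against the hypothesis.
  set F : Filter Y := Filter.comap g (𝓝 x) ⊓ Filter.principal {u | u ∈ K ∧ ¬ P (g u)} with hF
  have hne : F.NeBot := by
    rw [hF, Filter.inf_principal_neBot_iff]
    rintro U ⟨V, hV, hVU⟩
    obtain ⟨y, hy, hyV⟩ := ((Filter.not_eventually.mp hcon).and_eventually hV).exists
    simp only [Classical.not_imp] at hy
    obtain ⟨⟨u, huK, rfl⟩, hP⟩ := hy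
    exact ⟨u, hVU hyV, huK, hP⟩
  have hle : F ≤ Filter.principal K :=
    inf_le_right.trans (Filter.principal_mono.mpr fun u hu => hu.1)
  obtain ⟨w, hwK, hw⟩ := hK hle
  have hne' : (𝓝 w ⊓ F).NeBot := hw
  have hle' : 𝓝 w ⊓ F ≤ 𝓝[K] w := inf_le_inf_left _ hle
  have t1 : Filter.Tendsto g (𝓝 w ⊓ F) (𝓝 (g w)) := (hg w hwK).mono_left hle'
  have t2 : Filter.Tendsto g (𝓝 w ⊓ F) (𝓝 x) :=
    Filter.tendsto_iff_comap.mpr (inf_le_right.trans inf_le_left)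
  have hwx : g w = x := tendsto_nhds_unique t1 t2
  have hP := (h w hwK hwx).filter_mono hle'
  have hP' : ∀ᶠ u in 𝓝 w ⊓ F, u ∈ K ∧ ¬ P (g u) :=
    (inf_le_right.trans inf_le_right : 𝓝 w ⊓ F ≤ _) (Filter.mem_principal_self _)
  obtain ⟨u, hu1, hu2⟩ := (hP.and hP').exists
  exact hu2.2 hu1

/-! ### Developed edges -/

namespace SaddleConnection

/-- The map `g` takes the segment from `a` to `b` to the saddle connection, forwards or
backwards. -/
def Develops (γ : X.SaddleConnection) (g : ℂ → S) (a b : ℂ) : Prop :=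
  (∀ t ∈ Set.Icc (0 : ℝ) 1, g (AffineMap.lineMap a b t) = γ.path t) ∨
    ∀ t ∈ Set.Icc (0 : ℝ) 1, g (AffineMap.lineMap b a t) = γ.path t

variable {γ : X.SaddleConnection} {g : ℂ → S} {a b : ℂ}

lemma Develops.symm (h : γ.Develops g a b) : γ.Develops g b a := Or.symm h

lemma Develops.sub_eq_hol {K : Set ℂ} (hg : X.IsHalfTranslationOn g K) (hK : Convex ℝ K)
    (hne : (interior K).Nonempty) (ha : a ∈ K) (hb : b ∈ K) (h : γ.Develops g a b) :
    b - a = γ.hol ∨ b - a = -γ.hol := by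
  rcases h with h | h
  · exact hg.sub_eq_hol hK hne ha hb γ h
  · rcases hg.sub_eq_hol hK hne hb ha γ h with h | h
    · right; linear_combination -h
    · left; linear_combination -h

lemma Develops.mem_inner (h : γ.Develops g a b) {t : ℝ} (ht : t ∈ Set.Ioo (0 : ℝ) 1) :
    g (AffineMap.lineMap a b t) ∈ γ.inner := by
  rcases h with h | h
  · exact ⟨t, ht, (h t ⟨ht.1.le, ht.2.le⟩).symm⟩
  · refine ⟨1 - t, ⟨by linarith [ht.2], by linarith [ht.1]⟩, ?_⟩
    rw [← h (1 - t) ⟨by linarith [ht.2], by linarith [ht.1]⟩, AffineMap.lineMap_apply_one_sub]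

lemma Develops.isEndpoint_left (h : γ.Develops g a b) : γ.IsEndpoint (g a) := by
  rcases h with h | h
  · left; simpa using (h 0 (by simp)).symm
  · right; simpa using (h 1 (by simp)).symm

lemma notMem_of_mem_inner {x : S} (h : x ∈ γ.inner) : x ∉ X.Z := by
  obtain ⟨t, ht, rfl⟩ := h
  exact γ.path_notMem t ht

lemma IsEndpoint.mem {x : S} (h : γ.IsEndpoint x) : x ∈ X.Z := by
  rcases h with rfl | rfl
  · exact γ.path_zero
  · exact γ.path_one

end SaddleConnection

/-! ### Faces adjacent to an edge, and their development -/

namespace StraightTriangulation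

variable (τ : X.StraightTriangulation)

/-- The closed model triangle of a face. -/
def triangle (T : τ.Face) : Set ℂ := convexHull ℝ (Set.range (τ.vert T))

lemma convex_triangle (T : τ.Face) : Convex ℝ (τ.triangle T) := convex_convexHull ℝ _

lemma isCompact_triangle (T : τ.Face) : IsCompact (τ.triangle T) :=
  (Set.finite_range _).isCompact_convexHull ℝ

lemma vert_mem_triangle (T : τ.Face) (i : Fin 3) : τ.vert T i ∈ τ.triangle T :=
  subset_convexHull ℝ _ ⟨i, rfl⟩

lemma interior_triangle_nonempty (T : τ.Face) : (interior (τ.triangle T)).Nonempty := by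
  rw [triangle, interior_convexHull_nonempty_iff_affineSpan_eq_top,
    (τ.nondegenerate T).affineSpan_eq_top_iff_card_eq_finrank_add_one]
  simp [Complex.finrank_real_complex]

lemma isHalfTranslationOn_faceMap (T : τ.Face) :
    X.IsHalfTranslationOn (τ.faceMap T) (τ.triangle T) :=
  ⟨τ.continuousOn_faceMap T, τ.isHalfTranslationAt_faceMap T⟩

lemma develops_side (T : τ.Face) (i : Fin 3) :
    (τ.edge (τ.side T i)).Develops (τ.faceMap T) (τ.vert T i) (τ.vert T (i + 1)) := by
  refine (τ.faceMap_side T i).imp id fun h t ht => ?_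
  have := h (1 - t) ⟨by linarith [ht.2], by linarith [ht.1]⟩
  rwa [AffineMap.lineMap_apply_one_sub, sub_sub_cancel] at this

lemma vert_sub_vert (T : τ.Face) (i : Fin 3) :
    τ.vert T (i + 1) - τ.vert T i = (τ.edge (τ.side T i)).hol ∨
      τ.vert T (i + 1) - τ.vert T i = -(τ.edge (τ.side T i)).hol :=
  (τ.develops_side T i).sub_eq_hol (τ.isHalfTranslationOn_faceMap T) (τ.convex_triangle T)
    (τ.interior_triangle_nonempty T) (τ.vert_mem_triangle T i) (τ.vert_mem_triangle T (i + 1))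

/-- A property holds near `x` if it holds near `x` along the edges and on the faces. -/
lemma eventually_of_edges_of_faces [T2Space S] {x : S} (hx : x ∉ X.Z) {P : S → Prop}
    (he : ∀ e, ∀ t ∈ Set.Icc (0 : ℝ) 1, (τ.edge e).path t = x →
      ∀ᶠ s in 𝓝[Set.Icc (0 : ℝ) 1] t, P ((τ.edge e).path s))
    (hT : ∀ T, ∀ w ∈ τ.triangle T, τ.faceMap T w = x →
      ∀ᶠ u in 𝓝[τ.triangle T] w, P (τ.faceMap T u)) : ∀ᶠ y in 𝓝 x, P y := by
  have := τ.finite_edge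
  have := τ.finite_face
  have h1 : ∀ᶠ y in 𝓝 x, ∀ e, y ∈ (τ.edge e).path '' Set.Icc (0 : ℝ) 1 → P y :=
    Filter.eventually_all.mpr fun e =>
      eventually_of_isCompact isCompact_Icc (τ.edge e).continuousOn (he e)
  have h2 : ∀ᶠ y in 𝓝 x, ∀ T, y ∈ τ.faceMap T '' τ.triangle T → P y :=
    Filter.eventually_all.mpr fun T =>
      eventually_of_isCompact (τ.isCompact_triangle T) (τ.continuousOn_faceMap T) (hT T)
  filter_upwards [h1, h2, X.finite_Z.isClosed.isOpen_compl.mem_nhds hx] with y hy1 hy2 hy3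
  have hy : y ∈ X.Z ∪ (⋃ e, (τ.edge e).inner) ∪
    (⋃ T, τ.faceMap T '' interior (convexHull ℝ (Set.range (τ.vert T)))) := by
    rw [τ.cover]; trivial
  rcases hy with (hy | hy) | hy
  · exact absurd hy hy3
  · obtain ⟨e, t, ht, rfl⟩ := Set.mem_iUnion.mp hy
    exact hy1 e ⟨t, ⟨ht.1.le, ht.2.le⟩, rfl⟩
  · obtain ⟨T, w, hw, rfl⟩ := Set.mem_iUnion.mp hy
    exact hy2 T ⟨w, interior_subset hw, rfl⟩

/-- The common point is unmarked, so `t` is neither `0` nor `1`; disjointness and injectivity of the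
open edges do the rest. -/
lemma eq_of_path_eq {e e' : τ.Edge} {s t : ℝ} (hs : s ∈ Set.Ioo (0 : ℝ) 1)
    (ht : t ∈ Set.Icc (0 : ℝ) 1) (h : (τ.edge e').path t = (τ.edge e).path s) :
    e' = e ∧ t = s := by
  have hZ := (τ.edge e).path_notMem s hs
  have ht' : t ∈ Set.Ioo (0 : ℝ) 1 := by
    refine ⟨ht.1.lt_of_ne ?_, ht.2.lt_of_ne ?_⟩
    · rintro rfl
      exact hZ (h ▸ (τ.edge e').path_zero)
    · rintro rfl
      exact hZ (h ▸ (τ.edge e').path_one)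
  have hee : e' = e := by
    by_contra hne
    exact Set.disjoint_left.mp (τ.disjoint_edges e' e hne) ⟨t, ht', rfl⟩ ⟨s, hs, h.symm⟩
  subst hee
  exact ⟨rfl, (τ.edge e').injOn ht' hs h⟩

/-- On each side of an edge there is a face. -/
lemma exists_adjacent_face [T2Space S] (e : τ.Edge) {l : ℂ →L[ℝ] ℝ} (hl : l ≠ 0)
    (hle : l (τ.edge e).hol = 0) :
    ∃ T j A B, (A = τ.vert T j ∧ B = τ.vert T (j + 1) ∨ A = τ.vert T (j + 1) ∧ B = τ.vert T j) ∧
      τ.side T j = e ∧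
      (∀ t ∈ Set.Icc (0 : ℝ) 1, τ.faceMap T (AffineMap.lineMap A B t) = (τ.edge e).path t) ∧
      ((B - A = (τ.edge e).hol ∧ 0 < l (τ.vert T (j + 2) - A)) ∨
        (B - A = -(τ.edge e).hol ∧ l (τ.vert T (j + 2) - A) < 0)) := by
  by_contra hcon
  obtain ⟨φ, hφ, ε, hε, hev⟩ := (τ.edge e).straight (1 / 2) (by norm_num)
  have hεε := mul_self_eq_one_of_sign hε
  set x := (τ.edge e).path (1 / 2)
  have hhalf : (1 / 2 : ℝ) ∈ Set.Ioo (0 : ℝ) 1 := by norm_num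
  have hxin : x ∈ (τ.edge e).inner := ⟨1 / 2, hhalf, rfl⟩
  have hxφ : x ∈ φ.source := hev.self_of_nhds.1
  -- Were there no face on the positive side, a whole neighbourhood of the midpoint `x` would lie in
  -- the closed negative half-plane of the chart.
  have main : ∀ᶠ y in 𝓝 x, l (ε * (φ y - φ x)) ≤ 0 := by
    refine τ.eventually_of_edges_of_faces (SaddleConnection.notMem_of_mem_inner hxin) ?_ ?_
    · intro e' t ht hpt
      obtain ⟨rfl, rfl⟩ := τ.eq_of_path_eq hhalf ht hpt
      filter_upwards [hev.filter_mono nhdsWithin_le_nhds] with s hs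
      rw [hs.2]
      have : ε * (φ x + ε * ((s - 1 / 2 : ℝ) : ℂ) * (τ.edge e').hol - φ x) =
          (s - 1 / 2 : ℝ) • (τ.edge e').hol := by
        rw [Complex.real_smul]
        linear_combination ((s - 1 / 2 : ℝ) : ℂ) * (τ.edge e').hol * hεε
      rw [this, map_smul, hle, smul_zero]
    · intro T w hw hwx
      have hwint : w ∉ interior (τ.triangle T) := fun hmem =>
        Set.disjoint_left.mp (τ.disjoint_edge_face e T) hxin ⟨w, hmem, hwx⟩
      obtain ⟨j, t, ht, hwt⟩ := exists_side_of_notMem_interior (τ.nondegenerate T) hw hwint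
      have hAB : ∃ A B, (A = τ.vert T j ∧ B = τ.vert T (j + 1) ∨
          A = τ.vert T (j + 1) ∧ B = τ.vert T j) ∧ τ.side T j = e ∧
          (∀ t ∈ Set.Icc (0 : ℝ) 1, τ.faceMap T (AffineMap.lineMap A B t) = (τ.edge e).path t) ∧
          w = AffineMap.lineMap A B (1 / 2 : ℝ) := by
        rcases τ.develops_side T j with h | h
        · have h1 := h t ht
          rw [← hwt, hwx] at h1
          obtain ⟨h2, rfl⟩ := τ.eq_of_path_eq hhalf ht h1.symm
          exact ⟨_, _, Or.inl ⟨rfl, rfl⟩, h2, h2 ▸ h, hwt⟩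
        · have ht' : 1 - t ∈ Set.Icc (0 : ℝ) 1 := ⟨by linarith [ht.2], by linarith [ht.1]⟩
          have h1 := h (1 - t) ht'
          rw [AffineMap.lineMap_apply_one_sub, ← hwt, hwx] at h1
          obtain ⟨h2, h3⟩ := τ.eq_of_path_eq hhalf ht' h1.symm
          refine ⟨_, _, Or.inr ⟨rfl, rfl⟩, h2, h2 ▸ h, ?_⟩
          rw [hwt, ← h3, AffineMap.lineMap_apply_one_sub]
      obtain ⟨A, B, hAB, hside, hpath, hwAB⟩ := hAB
      have hA : A ∈ τ.triangle T := by
        rcases hAB with ⟨rfl, -⟩ | ⟨rfl, -⟩ <;> exact τ.vert_mem_triangle T _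
      have hB : B ∈ τ.triangle T := by
        rcases hAB with ⟨-, rfl⟩ | ⟨-, rfl⟩ <;> exact τ.vert_mem_triangle T _
      obtain ⟨ε', c, hε', hev'⟩ := (τ.isHalfTranslationOn_faceMap T).eventually_chart_eq
        (τ.convex_triangle T) (τ.interior_triangle_nonempty T) hw hφ (hwx ▸ hxφ)
      have hdir := mul_sub_eq_mul_hol (τ.convex_triangle T) hA hB hpath
        (hev.mono fun s hs => hs.2) (hwAB ▸ hev'.mono fun s hs => hs.2)
      have hdir' : ε * ε' * (B - A) = (τ.edge e).hol := by
        linear_combination ε * hdir + (τ.edge e).hol * hεε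
      have hC : l (ε * ε' * (τ.vert T (j + 2) - A)) ≤ 0 := by
        by_contra hpos
        push Not at hpos
        refine hcon ⟨T, j, A, B, hAB, hside, hpath, ?_⟩
        rcases sign_mul hε hε' with h | h
        · rw [h, one_mul] at hpos hdir'
          exact Or.inl ⟨hdir', hpos⟩
        · rw [h] at hpos hdir'
          rw [neg_one_mul, map_neg] at hpos
          exact Or.inr ⟨by linear_combination -hdir', by linarith⟩
      have hw0 := (hev'.self_of_nhdsWithin hw).2
      rw [hwx] at hw0
      obtain ⟨β, h1, h2, h3, -⟩ := exists_barycentric (τ.nondegenerate T)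
      filter_upwards [hev', self_mem_nhdsWithin] with u hu huT
      rw [hu.2, hw0]
      have hβ : ∀ i, 0 ≤ β i u := by
        have : u ∈ {w | ∀ i, 0 ≤ β i w} := h3 ▸ huT
        exact this
      have e1 := h1 u
      have e2 := h2 u
      rw [fin_three_sum _ j] at e1 e2
      have e3 : ((β j u : ℝ) : ℂ) = 1 - β (j + 1) u - β (j + 2) u := by
        rw [← Complex.ofReal_one, ← Complex.ofReal_sub, ← Complex.ofReal_sub]
        congr 1
        linarith
      -- The displacement splits into a part along the edge, which `l` kills, and a non-negative
      -- multiple of the direction to the third vertex.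
      have hkey : ∃ r : ℝ, ε * (ε' * u + c - (ε' * w + c)) =
          r • (τ.edge e).hol + β (j + 2) u • (ε * ε' * (τ.vert T (j + 2) - A)) := by
        rw [AffineMap.lineMap_apply] at hwAB
        simp only [vsub_eq_sub, Complex.real_smul, vadd_eq_add] at hwAB e2 ⊢
        rw [e3] at e2
        push_cast at hwAB
        rcases hAB with ⟨rfl, rfl⟩ | ⟨rfl, rfl⟩
        · refine ⟨β (j + 1) u - 1 / 2, ?_⟩
          push_cast
          rw [hwAB, ← hdir']
          linear_combination (-ε * ε') * e2
        · refine ⟨1 - β (j + 1) u - β (j + 2) u - 1 / 2, ?_⟩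
          push_cast
          rw [hwAB, ← hdir']
          linear_combination (-ε * ε') * e2
      obtain ⟨r, hr⟩ := hkey
      rw [hr, map_add, map_smul, map_smul, hle, smul_zero, zero_add, smul_eq_mul]
      exact mul_nonpos_of_nonneg_of_nonpos (hβ _) hC
  -- The chart is open, so it also contains points on the positive side.
  obtain ⟨N, hN⟩ : ∃ N, 0 < l N := by
    obtain ⟨v, hv⟩ : ∃ v, l v ≠ 0 := by
      by_contra! h
      exact hl (ContinuousLinearMap.ext h)
    rcases hv.lt_or_gt with h | h
    · exact ⟨-v, by rw [map_neg]; linarith⟩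
    · exact ⟨v, h⟩
  have ht : Filter.Tendsto (fun δ : ℝ => φ x + ε * (δ • N)) (𝓝[>] 0) (𝓝 (φ x)) := by
    have : Filter.Tendsto (fun δ : ℝ => φ x + ε * (δ • N)) (𝓝 0) (𝓝 (φ x + ε * ((0 : ℝ) • N))) :=
      Continuous.tendsto (by fun_prop) _
    rw [zero_smul, mul_zero, add_zero] at this
    exact this.mono_left nhdsWithin_le_nhds
  have hsymm := φ.symm.continuousAt (φ.map_source hxφ)
  rw [ContinuousAt, φ.left_inv hxφ] at hsymm
  obtain ⟨δ, ⟨h1, h2⟩, h3⟩ := (((hsymm.comp ht).eventually main).and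
    (ht.eventually (φ.open_target.mem_nhds (φ.map_source hxφ)))).and self_mem_nhdsWithin |>.exists
  simp only [Function.comp] at h1
  rw [φ.right_inv h2] at h1
  have : ε * (φ x + ε * (δ • N) - φ x) = δ • N := by
    linear_combination (δ • N) * hεε
  rw [this, map_smul, smul_eq_mul] at h1
  have h3' : 0 < δ := h3
  have := mul_pos h3' hN
  linarith

lemma convex_affine_preimage {K : Set ℂ} (hK : Convex ℝ K) (ε c : ℂ) :
    Convex ℝ ((fun u => ε * u + c) ⁻¹' K) := by
  intro x hx y hy a b ha hb hab
  have := hK hx hy ha hb hab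
  simp only [Set.mem_preimage, Complex.real_smul] at this ⊢
  convert this using 1
  have : (a : ℂ) + b = 1 := by exact_mod_cast hab
  linear_combination -c * this

lemma mul_lineMap_add (ε k a b : ℂ) (s : ℝ) :
    ε * AffineMap.lineMap a b s + k = AffineMap.lineMap (ε * a + k) (ε * b + k) s := by
  rw [AffineMap.lineMap_apply, AffineMap.lineMap_apply]
  simp only [vsub_eq_sub, Complex.real_smul, vadd_eq_add]
  ring

/-- A developed edge bounds a developed face on each side. -/
lemma exists_developed_face_of_forall [T2Space S] (e : τ.Edge) {l : ℂ →L[ℝ] ℝ} (hl : l ≠ 0)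
    {c d : ℂ} (hcd : d - c = (τ.edge e).hol ∨ d - c = -(τ.edge e).hol) (hlcd : l (d - c) = 0) :
    ∃ (t : ℂ) (g : ℂ → S) (e₁ e₂ : τ.Edge), 0 < l (t - c) ∧
      X.IsHalfTranslationOn g (convexHull ℝ {c, d, t}) ∧
      (∀ s ∈ Set.Icc (0 : ℝ) 1, g (AffineMap.lineMap c d s) = (τ.edge e).path s) ∧
      (τ.edge e₁).Develops g c t ∧ (τ.edge e₂).Develops g t d ∧
      (t - c = (τ.edge e₁).hol ∨ t - c = -(τ.edge e₁).hol) ∧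
      (d - t = (τ.edge e₂).hol ∨ d - t = -(τ.edge e₂).hol) ∧
      ∃ T, ∀ i, τ.side T i = e ∨ τ.side T i = e₁ ∨ τ.side T i = e₂ := by
  have hadj : ∃ T j A B ε, (ε = 1 ∨ ε = -1) ∧
      (A = τ.vert T j ∧ B = τ.vert T (j + 1) ∨ A = τ.vert T (j + 1) ∧ B = τ.vert T j) ∧
      τ.side T j = e ∧
      (∀ t ∈ Set.Icc (0 : ℝ) 1, τ.faceMap T (AffineMap.lineMap A B t) = (τ.edge e).path t) ∧
      B - A = ε * (d - c) ∧ 0 < l (ε * (τ.vert T (j + 2) - A)) := by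
    rcases hcd with h | h
    · obtain ⟨T, j, A, B, h1, h2, h3, h4⟩ := τ.exists_adjacent_face e hl (h ▸ hlcd)
      rcases h4 with ⟨h4, h5⟩ | ⟨h4, h5⟩
      · exact ⟨T, j, A, B, 1, Or.inl rfl, h1, h2, h3, by rw [h4, h, one_mul], by rwa [one_mul]⟩
      · refine ⟨T, j, A, B, -1, Or.inr rfl, h1, h2, h3, by rw [h4, h, neg_one_mul], ?_⟩
        rw [neg_one_mul, map_neg]
        linarith
    · have hle : (-l) (τ.edge e).hol = 0 := by
        rw [← hlcd, h, map_neg]; rfl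
      obtain ⟨T, j, A, B, h1, h2, h3, h4⟩ := τ.exists_adjacent_face e (neg_ne_zero.mpr hl) hle
      rw [neg_apply] at h4
      rcases h4 with ⟨h4, h5⟩ | ⟨h4, h5⟩
      · refine ⟨T, j, A, B, -1, Or.inr rfl, h1, h2, h3, by rw [h4, h]; ring, ?_⟩
        rw [neg_one_mul, map_neg]
        linarith
      · refine ⟨T, j, A, B, 1, Or.inl rfl, h1, h2, h3, by rw [h4, h]; ring, ?_⟩
        rw [one_mul]
        linarith
  obtain ⟨T, j, A, B, ε, hε, hAB, hside, hpath, hBA, hpos⟩ := hadj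
  have hεε := mul_self_eq_one_of_sign hε
  have hj1 : j + 1 + 1 = j + 2 := by rw [add_assoc]; rfl
  have hj2 : j + 2 + 1 = j := by rw [add_assoc]; exact add_zero j
  set C := τ.vert T (j + 2)
  obtain ⟨e₁, e₂, hd1, hd2, hT⟩ : ∃ e₁ e₂ : τ.Edge, (τ.edge e₁).Develops (τ.faceMap T) A C ∧
      (τ.edge e₂).Develops (τ.faceMap T) C B ∧
      ∀ i, τ.side T i = e ∨ τ.side T i = e₁ ∨ τ.side T i = e₂ := by
    have hs1 := τ.develops_side T (j + 1)
    have hs2 := τ.develops_side T (j + 2)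
    rw [hj1] at hs1
    rw [hj2] at hs2
    rcases hAB with ⟨rfl, rfl⟩ | ⟨rfl, rfl⟩
    · refine ⟨τ.side T (j + 2), τ.side T (j + 1), hs2.symm, hs1.symm, fun i => ?_⟩
      rcases fin_three_eq i j with rfl | rfl | rfl
      · exact Or.inl hside
      · exact Or.inr (Or.inr rfl)
      · exact Or.inr (Or.inl rfl)
    · refine ⟨τ.side T (j + 1), τ.side T (j + 2), hs1, hs2, fun i => ?_⟩
      rcases fin_three_eq i j with rfl | rfl | rfl
      · exact Or.inl hside
      · exact Or.inr (Or.inl rfl)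
      · exact Or.inr (Or.inr rfl)
  have hA : A ∈ τ.triangle T := by
    rcases hAB with ⟨rfl, -⟩ | ⟨rfl, -⟩ <;> exact τ.vert_mem_triangle T _
  have hB : B ∈ τ.triangle T := by
    rcases hAB with ⟨-, rfl⟩ | ⟨-, rfl⟩ <;> exact τ.vert_mem_triangle T _
  have hCm : C ∈ τ.triangle T := τ.vert_mem_triangle T _
  -- The map `u ↦ ε * u + k` takes `c`, `d`, `t` to the vertices `A`, `B`, `C` of the model
  -- triangle.
  set k := A - ε * c with hk
  set t := c + ε * (C - A) with ht
  have mc : ε * c + k = A := by rw [hk]; ring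
  have md : ε * d + k = B := by rw [hk]; linear_combination -hBA
  have mt : ε * t + k = C := by rw [hk, ht]; linear_combination (C - A) * hεε
  have hdev : ∀ {γ : X.SaddleConnection} {a b : ℂ},
      γ.Develops (τ.faceMap T) (ε * a + k) (ε * b + k) →
      γ.Develops (fun u => τ.faceMap T (ε * u + k)) a b := by
    intro γ a b h
    refine h.imp (fun h s hs => ?_) (fun h s hs => ?_)
    · simp only [mul_lineMap_add]; exact h s hs
    · simp only [mul_lineMap_add]; exact h s hs
  have hsgn : ∀ {x y h : ℂ}, y = ε * x → (y = h ∨ y = -h) → (x = h ∨ x = -h) := by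
    intro x y h hxy hy
    rcases hε with rfl | rfl
    · rw [one_mul] at hxy
      rwa [← hxy]
    · rcases hy with hy | hy
      · right; linear_combination hxy - hy
      · left; linear_combination hxy - hy
  have hhol : ∀ {γ : X.SaddleConnection} {a b : ℂ}, a ∈ τ.triangle T → b ∈ τ.triangle T →
      γ.Develops (τ.faceMap T) a b → (b - a = γ.hol ∨ b - a = -γ.hol) := fun ha hb h =>
    h.sub_eq_hol (τ.isHalfTranslationOn_faceMap T) (τ.convex_triangle T)
      (τ.interior_triangle_nonempty T) ha hb
  refine ⟨t, fun u => τ.faceMap T (ε * u + k), e₁, e₂, ?_, ?_, ?_, ?_, ?_, ?_, ?_, T, hT⟩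
  · rw [ht, add_sub_cancel_left]; exact hpos
  · refine ((τ.isHalfTranslationOn_faceMap T).comp_affine hε).mono
      (convexHull_min ?_ (convex_affine_preimage (τ.convex_triangle T) ε k))
    rintro u (rfl | rfl | rfl)
    · simpa only [Set.mem_preimage, mc] using hA
    · simpa only [Set.mem_preimage, md] using hB
    · simpa only [Set.mem_preimage, mt] using hCm
  · intro s hs
    simp only [mul_lineMap_add, mc, md]
    exact hpath s hs
  · apply hdev; rwa [mc, mt]
  · apply hdev; rwa [mt, md]
  · exact hsgn (by rw [← mc, ← mt]; ring) (hhol hA hCm hd1)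
  · exact hsgn (by rw [← md, ← mt]; ring) (hhol hCm hB hd2)

/-- A face developed across a developed edge, on the side where `l` is positive. -/
lemma exists_developed_face [T2Space S] (e : τ.Edge) {l : ℂ →L[ℝ] ℝ} (hl : l ≠ 0) {c d : ℂ}
    (hcd : d - c = (τ.edge e).hol ∨ d - c = -(τ.edge e).hol) (hlcd : l (d - c) = 0) {f : ℂ → S}
    (hf : (τ.edge e).Develops f c d) :
    ∃ (t : ℂ) (g : ℂ → S) (e₁ e₂ : τ.Edge), 0 < l (t - c) ∧
      X.IsHalfTranslationOn g (convexHull ℝ {c, d, t}) ∧ Set.EqOn g f (segment ℝ c d) ∧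
      (τ.edge e₁).Develops g c t ∧ (τ.edge e₂).Develops g t d ∧
      (t - c = (τ.edge e₁).hol ∨ t - c = -(τ.edge e₁).hol) ∧
      (d - t = (τ.edge e₂).hol ∨ d - t = -(τ.edge e₂).hol) ∧
      ∃ T, ∀ i, τ.side T i = e ∨ τ.side T i = e₁ ∨ τ.side T i = e₂ := by
  have hswap : ∀ {x y h : ℂ}, (y - x = h ∨ y - x = -h) → (x - y = h ∨ x - y = -h) := by
    intro x y h hy
    rcases hy with hy | hy
    · right; linear_combination -hy
    · left; linear_combination -hy
  rcases hf with hf | hf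
  · obtain ⟨t, g, e₁, e₂, h1, h2, h3, h4⟩ := τ.exists_developed_face_of_forall e hl hcd hlcd
    refine ⟨t, g, e₁, e₂, h1, h2, ?_, h4⟩
    rw [segment_eq_image_lineMap]
    rintro _ ⟨s, hs, rfl⟩
    rw [h3 s hs, hf s hs]
  · have hldc : l (c - d) = 0 := by rw [← neg_sub, map_neg, hlcd, neg_zero]
    obtain ⟨t, g, e₁, e₂, h1, h2, h3, h4, h5, h6, h7, T, hT⟩ :=
      τ.exists_developed_face_of_forall e hl (hswap hcd) hldc
    refine ⟨t, g, e₂, e₁, ?_, ?_, ?_, h5.symm, h4.symm, hswap h7, hswap h6, T, fun i => ?_⟩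
    · have : t - c = (t - d) + (d - c) := by ring
      rw [this, map_add, hlcd, add_zero]
      exact h1
    · rwa [Set.insert_comm]
    · rw [segment_symm, segment_eq_image_lineMap]
      rintro _ ⟨s, hs, rfl⟩
      rw [h3 s hs, hf s hs]
    · have := hT i
      tauto

end StraightTriangulation

/-! ### Half-rectangles in linear coordinates -/

/-- The oriented area form of two real coordinates of the plane, as a functional of its second
argument. -/
noncomputable def cross (ξ η : ℂ →L[ℝ] ℝ) (u : ℂ) : ℂ →L[ℝ] ℝ := ξ u • η - η u • ξ

lemma cross_apply (ξ η : ℂ →L[ℝ] ℝ) (u w : ℂ) : cross ξ η u w = ξ u * η w - η u * ξ w := rfl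

/-- Half of the rectangle with diagonal from `a` to `b` and sides parallel to the axes of the
coordinates `ξ` and `η`. -/
def halfRectangle (ξ η : ℂ →L[ℝ] ℝ) (a b : ℂ) : Set ℂ :=
  {w | ξ a ≤ ξ w ∧ η w ≤ η b ∧ cross ξ η (b - a) a ≤ cross ξ η (b - a) w}

/-- A non-zero functional is an open map, so the interior of its closed half-plane is the open
half-plane. -/
lemma lt_of_mem_interior {l : ℂ →L[ℝ] ℝ} (hl : l ≠ 0) {K : Set ℂ} {b : ℝ}
    (hK : ∀ w ∈ K, b ≤ l w) {w : ℂ} (hw : w ∈ interior K) : b < l w := by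
  have hsurj : Function.Surjective l := by
    have : (l : ℂ →ₗ[ℝ] ℝ) ≠ 0 := fun h => hl (ContinuousLinearMap.coe_injective h)
    exact LinearMap.surjective this
  have hopen := l.isOpenMap hsurj
  have h2 : interior (l ⁻¹' Set.Ici b) = l ⁻¹' (interior (Set.Ici b)) :=
    (hopen.preimage_interior_eq_interior_preimage l.continuous _).symm
  have h3 : w ∈ interior (l ⁻¹' Set.Ici b) := interior_mono (fun v hv => hK v hv) hw
  rw [h2, interior_Ici] at h3
  exact h3

lemma gt_of_mem_interior {l : ℂ →L[ℝ] ℝ} (hl : l ≠ 0) {K : Set ℂ} {b : ℝ}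
    (hK : ∀ w ∈ K, l w ≤ b) {w : ℂ} (hw : w ∈ interior K) : l w < b := by
  have := lt_of_mem_interior (neg_ne_zero.mpr hl) (b := -b) (K := K)
    (fun v hv => neg_le_neg (hK v hv)) hw
  rw [neg_apply] at this
  linarith

section Coordinates

variable {ξ η : ℂ →L[ℝ] ℝ} (hinj : ∀ w, ξ w = 0 → η w = 0 → w = 0)
include hinj

lemma ext_coords {u w : ℂ} (h1 : ξ u = ξ w) (h2 : η u = η w) : u = w :=
  sub_eq_zero.mp (hinj _ (by rw [map_sub, h1, sub_self]) (by rw [map_sub, h2, sub_self]))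

lemma eq_lineMap_of_cross_eq {c d w : ℂ} (hU : 0 < ξ (d - c))
    (hl : cross ξ η (d - c) w = cross ξ η (d - c) c) :
    w = AffineMap.lineMap c d ((ξ w - ξ c) / ξ (d - c)) := by
  rw [cross_apply, cross_apply] at hl
  rw [AffineMap.lineMap_apply, vsub_eq_sub, vadd_eq_add]
  apply ext_coords hinj
  · rw [map_add, map_smul, smul_eq_mul]
    field_simp
    ring
  · rw [map_add, map_smul, smul_eq_mul]
    field_simp
    linarith

/-- Both coordinates increase from `c` to `d`, so on this line one lower bound on `ξ` and one upper
bound on `η` confine the parameter to `[0, 1]`. -/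
lemma mem_segment_of_cross_eq {c d w : ℂ} (hU : 0 < ξ (d - c)) (hV : 0 < η (d - c))
    (hl : cross ξ η (d - c) w = cross ξ η (d - c) c) (h1 : ξ c ≤ ξ w) (h2 : η w ≤ η d) :
    w ∈ segment ℝ c d := by
  rw [eq_lineMap_of_cross_eq hinj hU hl, segment_eq_image_lineMap]
  refine ⟨_, ⟨div_nonneg (by linarith) hU.le, (div_le_one hU).mpr ?_⟩, rfl⟩
  rw [cross_apply, cross_apply] at hl
  have h3 : η w - η c ≤ η (d - c) := by rw [map_sub]; linarith
  by_contra hcon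
  push Not at hcon
  nlinarith

lemma exists_lineMap_of_cross_eq {c d w : ℂ} (hU : 0 < ξ (d - c)) (hV : 0 < η (d - c))
    (hl : cross ξ η (d - c) w = cross ξ η (d - c) c) (h1 : ξ c < ξ w) (h2 : η w < η d) :
    ∃ s ∈ Set.Ioo (0 : ℝ) 1, w = AffineMap.lineMap c d s := by
  refine ⟨_, ⟨div_pos (by linarith) hU, (div_lt_one hU).mpr ?_⟩,
    eq_lineMap_of_cross_eq hinj hU hl⟩
  rw [cross_apply, cross_apply] at hl
  have h3 : η w - η c < η (d - c) := by rw [map_sub]; linarith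
  by_contra hcon
  push Not at hcon
  nlinarith

/-- By Cramer's rule the barycentric coordinates of `w` are quotients of oriented areas; the three
sign conditions make them non-negative. -/
lemma mem_convexHull_of_cross {c d t w : ℂ} (ht : 0 < cross ξ η (d - c) (t - c))
    (h1 : 0 ≤ cross ξ η (d - c) (w - c)) (h2 : cross ξ η (t - c) (w - c) ≤ 0)
    (h3 : cross ξ η (d - t) (w - t) ≤ 0) : w ∈ convexHull ℝ {c, d, t} := by
  set D := cross ξ η (d - c) (t - c) with hD
  set α := -cross ξ η (t - c) (w - c) / D with hα
  set β := cross ξ η (d - c) (w - c) / D with hβ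
  have hα0 : 0 ≤ α := div_nonneg (by linarith) ht.le
  have hβ0 : 0 ≤ β := div_nonneg h1 ht.le
  have hαβ : α + β ≤ 1 := by
    rw [hα, hβ, ← add_div, div_le_one ht]
    simp only [cross_apply, map_sub, hD] at h3 ⊢
    linarith
  have hw : w = ∑ i, (![1 - α - β, α, β] : Fin 3 → ℝ) i • (![c, d, t] : Fin 3 → ℂ) i := by
    have hDne := ht.ne'
    rw [Fin.sum_univ_three]
    apply ext_coords hinj
    · simp only [map_add, map_smul, smul_eq_mul, Matrix.cons_val]
      rw [hα, hβ]
      field_simp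
      rw [hD]
      simp only [cross_apply, map_sub]
      ring
    · simp only [map_add, map_smul, smul_eq_mul, Matrix.cons_val]
      rw [hα, hβ]
      field_simp
      rw [hD]
      simp only [cross_apply, map_sub]
      ring
  rw [hw]
  refine (convex_convexHull ℝ _).sum_mem (fun i _ => ?_) ?_ (fun i _ => subset_convexHull ℝ _ ?_)
  · fin_cases i
    · change 0 ≤ 1 - α - β; linarith
    · exact hα0
    · exact hβ0
  · rw [Fin.sum_univ_three]
    simp only [Matrix.cons_val]
    ring
  · fin_cases i <;> simp

end Coordinates

/-! ### Immersed rectangles from the absence of monochromatic faces -/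

namespace StraightTriangulation

variable (τ : X.StraightTriangulation)

/-- If no triangle has all its edges of positive slope in the coordinates `ξ`, `η`, then a half-
rectangle whose hypotenuse is an edge of positive slope immerses. This is the inductive step: the
half-rectangle is immersed up to a developed edge from `c` to `d` that crosses it. -/
lemma exists_halfRectangle_of_developed [T2Space S] {ξ η : ℂ →L[ℝ] ℝ}
    (hinj : ∀ w, ξ w = 0 → η w = 0 → w = 0) {N : ℂ} (hN : ξ N = 0) (hN' : η N = 1)
    {δ : ℝ} (hξ : ∀ e, δ ≤ |ξ (τ.edge e).hol|) (hη : ∀ e, δ ≤ |η (τ.edge e).hol|)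
    (hδ : 0 < δ)
    (hmono : ∀ T, ¬ ∀ i, 0 < ξ (τ.edge (τ.side T i)).hol * η (τ.edge (τ.side T i)).hol)
    {a b : ℂ} {f₀ : ℂ → S} (hU₀ : 0 < ξ (b - a)) (hV₀ : 0 < η (b - a)) (n : ℕ) :
    ∀ (c d : ℂ) (e : τ.Edge) (f g : ℂ → S), ξ c ≤ ξ a → η a ≤ η c → η b ≤ η d → ξ d ≤ ξ b →
      0 < ξ (d - c) → 0 < η (d - c) →
      (d - c = (τ.edge e).hol ∨ d - c = -(τ.edge e).hol) → (τ.edge e).Develops f c d →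
      X.IsHalfTranslationOn g
        (halfRectangle ξ η a b ∩ {w | cross ξ η (d - c) w ≤ cross ξ η (d - c) c}) →
      (∀ w ∈ halfRectangle ξ η a b, cross ξ η (d - c) w = cross ξ η (d - c) c → g w = f w) →
      Set.EqOn g f₀ (segment ℝ a b) → (η b - η c) + (ξ d - ξ a) ≤ n * δ →
      ∃ g, X.IsHalfTranslationOn g (halfRectangle ξ η a b) ∧ Set.EqOn g f₀ (segment ℝ a b) := by
  have hξ0 : ξ ≠ 0 := by rintro rfl; simp at hU₀
  have hη0 : η ≠ 0 := by rintro rfl; simp at hV₀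
  have hsegH : segment ℝ a b ⊆ halfRectangle ξ η a b := by
    rw [segment_eq_image_lineMap]
    rintro _ ⟨s, hs, rfl⟩
    rw [AffineMap.lineMap_apply, vsub_eq_sub, vadd_eq_add]
    rw [halfRectangle, Set.mem_ofPred_eq, cross_apply, cross_apply]
    simp only [map_add, map_smul, smul_eq_mul]
    refine ⟨by nlinarith [hs.1], ?_, by nlinarith⟩
    have : η (b - a) = η b - η a := map_sub _ _ _
    nlinarith [hs.2]
  -- The hypotenuse stays on the near side of every front, so no extension changes the map on it.
  have hsegl : ∀ {c d : ℂ}, ξ c ≤ ξ a → η a ≤ η c → η b ≤ η d → ξ d ≤ ξ b → 0 < ξ (d - c) →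
      0 < η (d - c) → ∀ w ∈ segment ℝ a b, cross ξ η (d - c) w ≤ cross ξ η (d - c) c := by
    intro c d h1 h2 h3 h4 h5 h6 w hw
    have hlin : IsLinearMap ℝ (cross ξ η (d - c)) :=
      ⟨(cross ξ η (d - c)).map_add, (cross ξ η (d - c)).map_smul⟩
    refine (convex_halfSpace_le hlin (cross ξ η (d - c) c)).segment_subset ?_ ?_ hw
    · simp only [Set.mem_ofPred_eq, cross_apply]
      nlinarith
    · simp only [map_sub] at h5 h6
      simp only [Set.mem_ofPred_eq, cross_apply, map_sub]
      linarith [mul_nonneg h5.le (sub_nonneg.mpr h3), mul_nonneg h6.le (sub_nonneg.mpr h4)]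
  -- The front enters at or beyond the left side (`c`) and leaves at or beyond the top (`d`). The
  -- sum of `η b - η c` and `ξ d - ξ a` measures what is left, and each new front lowers it by at
  -- least `δ`.
  induction n with
  | zero =>
    intro c d e f g h1 h2 h3 h4 hU hV hhol hf hg hgf hgf₀ hn
    -- With nothing left, `c` is at least as high as the top or `d` is not to the right of the left
    -- side, so the whole half-rectangle is on the near side of the front.
    refine ⟨g, hg.mono fun w hw => ⟨hw, ?_⟩, hgf₀⟩
    simp only [Nat.cast_zero, zero_mul] at hn
    obtain ⟨hw1, hw2, -⟩ := hw
    simp only [Set.mem_ofPred_eq, cross_apply]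
    rcases le_total (η b) (η c) with h | h
    · nlinarith
    · have : ξ d ≤ ξ a := by linarith
      have e1 : ξ (d - c) = ξ d - ξ c := map_sub _ _ _
      have e2 : η (d - c) = η d - η c := map_sub _ _ _
      nlinarith
  | succ n ih =>
    intro c d e f g h1 h2 h3 h4 hU hV hhol hf hg hgf hgf₀ hn
    have e1 : ξ (d - c) = ξ d - ξ c := map_sub _ _ _
    have e2 : η (d - c) = η d - η c := map_sub _ _ _
    set l := cross ξ η (d - c) with hl
    have hlw : ∀ w, l w = (ξ d - ξ c) * η w - (η d - η c) * ξ w := fun w => by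
      rw [hl, cross_apply, e1, e2]
    have hl0 : l ≠ 0 := by
      intro h
      have := congrArg (fun l : ℂ →L[ℝ] ℝ => l N) h
      simp only [hlw, hN, hN', zero_apply] at this
      linarith
    have hlcd : l (d - c) = 0 := by rw [hl, cross_apply]; ring
    obtain ⟨t, k, f₁, f₂, hpos, hk, hkf, hd1, hd2, hh1, hh2, T, hT⟩ :=
      τ.exists_developed_face e hl0 hhol hlcd hf
    have hnot : ¬ (0 < ξ (t - c) * η (t - c) ∧ 0 < ξ (d - t) * η (d - t)) := by
      rintro ⟨k1, k2⟩
      have hsign : ∀ {v : ℂ} {e : τ.Edge}, (v = (τ.edge e).hol ∨ v = -(τ.edge e).hol) →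
          0 < ξ v * η v → 0 < ξ (τ.edge e).hol * η (τ.edge e).hol := by
        rintro v e (rfl | rfl) h
        · exact h
        · simpa using h
      refine hmono T fun i => ?_
      rcases hT i with h | h | h <;> rw [h]
      · exact hsign hhol (mul_pos hU hV)
      · exact hsign hh1 k1
      · exact hsign hh2 k2
    have hbound : ∀ {l : ℂ →L[ℝ] ℝ}, (∀ e, δ ≤ |l (τ.edge e).hol|) → ∀ {v : ℂ} {e : τ.Edge},
        (v = (τ.edge e).hol ∨ v = -(τ.edge e).hol) → δ ≤ |l v| := by
      rintro l hl v e (rfl | rfl)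
      · exact hl e
      · rw [map_neg, abs_neg]; exact hl e
    have b1 := hbound hξ hh1
    have b2 := hbound hη hh1
    have b3 := hbound hξ hh2
    have b4 := hbound hη hh2
    have e3 : ξ (t - c) = ξ t - ξ c := map_sub _ _ _
    have e4 : η (t - c) = η t - η c := map_sub _ _ _
    have e5 : ξ (d - t) = ξ d - ξ t := map_sub _ _ _
    have e6 : η (d - t) = η d - η t := map_sub _ _ _
    rw [e3] at b1
    rw [e4] at b2
    rw [e5] at b3
    rw [e6] at b4
    rw [e3, e4, e5, e6] at hnot
    have hpos' : 0 < (ξ d - ξ c) * (η t - η c) - (η d - η c) * (ξ t - ξ c) := by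
      have := hpos
      rwa [hlw, e3, e4] at this
    rw [e1] at hU
    rw [e2] at hV
    -- The face is glued on along the front. In the interior of `K` the front consists of interior
    -- points of an edge, hence of unmarked points.
    have hglue : ∀ K ⊆ halfRectangle ξ η a b,
        (∀ w ∈ K, l c ≤ l w → w ∈ convexHull ℝ {c, d, t}) →
        ∃ g' : ℂ → S, X.IsHalfTranslationOn g' K ∧ (∀ w ∈ K, l w ≤ l c → g' w = g w) ∧
          ∀ w ∈ K, l c ≤ l w → g' w = k w := by
      intro K hKH hK
      refine IsHalfTranslationOn.glue hl0 (hg.mono ?_) (hk.mono ?_) ?_ ?_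
      · exact Set.inter_subset_inter_left _ hKH
      · exact fun w hw => hK w hw.1 hw.2
      · intro w hw hlwc
        have hwH := hKH hw
        rw [hgf w hwH hlwc]
        refine (hkf (mem_segment_of_cross_eq hinj (e1 ▸ hU) (e2 ▸ hV) hlwc ?_ ?_)).symm
        · linarith [hwH.1]
        · linarith [hwH.2.1]
      · intro w hw hlwc
        rw [hgf w (hKH (interior_subset hw)) hlwc]
        have i1 := lt_of_mem_interior hξ0 (fun v hv => (hKH hv).1) hw
        have i2 := gt_of_mem_interior hη0 (fun v hv => (hKH hv).2.1) hw
        obtain ⟨s, hs, rfl⟩ := exists_lineMap_of_cross_eq hinj (e1 ▸ hU) (e2 ▸ hV) hlwc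
          (by linarith) (by linarith)
        exact SaddleConnection.notMem_of_mem_inner (hf.mem_inner hs)
    have hhull : ∀ w, l c ≤ l w →
        (ξ t - ξ c) * (η w - η c) - (η t - η c) * (ξ w - ξ c) ≤ 0 →
        (ξ d - ξ t) * (η w - η t) - (η d - η t) * (ξ w - ξ t) ≤ 0 →
        w ∈ convexHull ℝ {c, d, t} := by
      intro w k1 k2 k3
      refine mem_convexHull_of_cross hinj hpos ?_ ?_ ?_
      · rw [map_sub]; exact sub_nonneg.mpr k1
      · simp only [cross_apply, map_sub]; linarith
      · simp only [cross_apply, map_sub]; linarith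
    -- A side of negative slope cuts off nothing: the part of the half-rectangle beyond the front is
    -- on the inner side of it. The same holds for `hright`.
    have hleft : ∀ w ∈ halfRectangle ξ η a b, l c ≤ l w → ξ t < ξ c → η c < η t →
        (ξ t - ξ c) * (η w - η c) - (η t - η c) * (ξ w - ξ c) ≤ 0 := by
      intro w hw k1 k2 k3
      have hx : ξ c ≤ ξ w := h1.trans hw.1
      rw [hlw, hlw] at k1
      have hy : η c ≤ η w := by
        by_contra hcon
        push Not at hcon
        linarith [mul_pos hU (sub_pos.mpr hcon), mul_nonneg hV.le (sub_nonneg.mpr hx)]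
      linarith [mul_nonneg (sub_nonneg.mpr k2.le) (sub_nonneg.mpr hy),
        mul_nonneg (sub_nonneg.mpr k3.le) (sub_nonneg.mpr hx)]
    have hright : ∀ w ∈ halfRectangle ξ η a b, l c ≤ l w → ξ t < ξ d → η d < η t →
        (ξ d - ξ t) * (η w - η t) - (η d - η t) * (ξ w - ξ t) ≤ 0 := by
      intro w hw k1 k2 k3
      have hy : η w ≤ η d := hw.2.1.trans h3
      rw [hlw, hlw] at k1
      have hx : ξ w ≤ ξ d := by
        by_contra hcon
        push Not at hcon
        linarith [mul_nonneg hU.le (sub_nonneg.mpr hy), mul_pos hV (sub_pos.mpr hcon)]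
      linarith [mul_nonneg (sub_nonneg.mpr k2.le) (sub_nonneg.mpr hy),
        mul_nonneg (sub_nonneg.mpr k3.le) (sub_nonneg.mpr hx)]
    have hne : ∀ {x : ℝ}, δ ≤ |x| → x ≠ 0 := by
      rintro x hx rfl
      rw [abs_zero] at hx
      linarith
    have n1 := hne b1
    have n2 := hne b2
    have n3 := hne b3
    have n4 := hne b4
    -- The slopes of the sides from `c` to `t` and from `t` to `d` are both negative, or negative
    -- and positive, or positive and negative.
    have cases : (ξ t < ξ c ∧ η c < η t ∧ ξ t < ξ d ∧ η d < η t) ∨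
        (ξ t < ξ c ∧ η c < η t ∧ ξ t < ξ d ∧ η t < η d) ∨
        (ξ c < ξ t ∧ η c < η t ∧ ξ t < ξ d ∧ η d < η t) := by
      rcases lt_or_gt_of_ne n1 with m1 | m1
      · have m2 : ξ t < ξ d := by linarith
        have m3 : η c < η t := by
          rcases lt_or_gt_of_ne n2 with m4 | m4
          · exfalso
            have : η t < η d := by linarith
            exact hnot ⟨mul_pos_of_neg_of_neg m1 m4, mul_pos (by linarith) (by linarith)⟩
          · linarith
        rcases lt_or_gt_of_ne n4 with m4 | m4
        · exact Or.inl ⟨by linarith, m3, m2, by linarith⟩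
        · exact Or.inr (Or.inl ⟨by linarith, m3, m2, by linarith⟩)
      · have m2 : η c < η t := by nlinarith
        have m3 : ¬ 0 < (ξ d - ξ t) * (η d - η t) := fun h =>
          hnot ⟨mul_pos m1 (by linarith), h⟩
        have m4 : (ξ d - ξ t) * (η d - η t) < 0 := lt_of_le_of_ne (not_lt.mp m3) (mul_ne_zero n3 n4)
        rcases mul_neg_iff.mp m4 with ⟨m5, m6⟩ | ⟨m5, m6⟩
        · exact Or.inr (Or.inr ⟨by linarith, m2, by linarith, by linarith⟩)
        · nlinarith
    rcases cases with ⟨c1, c2, c3, c4⟩ | ⟨c1, c2, c3, c4⟩ | ⟨c1, c2, c3, c4⟩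
    · obtain ⟨g', hg', hg1, -⟩ := hglue _ subset_rfl fun w hw hlw =>
        hhull w hlw (hleft w hw hlw c1 c2) (hright w hw hlw c3 c4)
      refine ⟨g', hg', fun w hw => ?_⟩
      rw [hg1 w (hsegH hw) (hsegl h1 h2 h3 h4 (e1 ▸ hU) (e2 ▸ hV) w hw), hgf₀ hw]
    · have hU' : 0 < ξ (d - t) := by linarith
      have hV' : 0 < η (d - t) := by linarith
      have h1' : ξ t ≤ ξ a := by linarith
      have h2' : η a ≤ η t := by linarith
      obtain ⟨g', hg', hg1, hg2⟩ := hglue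
        (halfRectangle ξ η a b ∩ {w | cross ξ η (d - t) w ≤ cross ξ η (d - t) t})
        Set.inter_subset_left fun w hw hlw =>
          hhull w hlw (hleft w hw.1 hlw c1 c2) (by
            have := hw.2
            simp only [Set.mem_ofPred_eq, cross_apply, e5, e6] at this
            linarith)
      refine ih t d f₂ k g' h1' h2' h3 h4 hU' hV' hh2 hd2 hg' ?_ ?_ ?_
      · intro w hw hlt
        refine hg2 w ⟨hw, hlt.le⟩ ?_
        rw [cross_apply, cross_apply, e5, e6] at hlt
        rw [hlw, hlw]
        have hy : η w ≤ η d := hw.2.1.trans h3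
        by_contra hcon
        push Not at hcon
        -- On the line through `t` and `d`, the area over the old front is proportional to `η d - η
        -- w`, with the value at `t` positive; so points no higher than `d` are not before the old
        -- front.
        have key : ((ξ d - ξ c) * (η w - η d) - (η d - η c) * (ξ w - ξ d)) * (η d - η t) =
            ((ξ d - ξ c) * (η t - η c) - (η d - η c) * (ξ t - ξ c)) * (η d - η w) := by
          linear_combination (η d - η c) * hlt
        have k1 : 0 ≤ ((ξ d - ξ c) * (η t - η c) - (η d - η c) * (ξ t - ξ c)) * (η d - η w) :=
          mul_nonneg hpos'.le (by linarith)
        have k2 : ((ξ d - ξ c) * (η w - η d) - (η d - η c) * (ξ w - ξ d)) * (η d - η t) < 0 :=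
          mul_neg_of_neg_of_pos (by linarith) (by linarith)
        linarith
      · intro w hw
        rw [hg1 w ⟨hsegH hw, hsegl h1' h2' h3 h4 hU' hV' w hw⟩
          (hsegl h1 h2 h3 h4 (e1 ▸ hU) (e2 ▸ hV) w hw), hgf₀ hw]
      · rw [abs_of_pos (by linarith)] at b2
        push_cast at hn
        linarith
    · have hU' : 0 < ξ (t - c) := by linarith
      have hV' : 0 < η (t - c) := by linarith
      have h3' : η b ≤ η t := by linarith
      have h4' : ξ t ≤ ξ b := by linarith
      obtain ⟨g', hg', hg1, hg2⟩ := hglue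
        (halfRectangle ξ η a b ∩ {w | cross ξ η (t - c) w ≤ cross ξ η (t - c) c})
        Set.inter_subset_left fun w hw hlw =>
          hhull w hlw (by
            have := hw.2
            simp only [Set.mem_ofPred_eq, cross_apply, e3, e4] at this
            linarith) (hright w hw.1 hlw c3 c4)
      refine ih c t f₁ k g' h1 h2 h3' h4' hU' hV' hh1 hd1 hg' ?_ ?_ ?_
      · intro w hw hlt
        refine hg2 w ⟨hw, hlt.le⟩ ?_
        rw [cross_apply, cross_apply, e3, e4] at hlt
        rw [hlw, hlw]
        have hx : ξ c ≤ ξ w := h1.trans hw.1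
        by_contra hcon
        push Not at hcon
        -- On the line through `c` and `t`, the area over the old front is proportional to `ξ w - ξ
        -- c`.
        have key : ((ξ d - ξ c) * (η w - η c) - (η d - η c) * (ξ w - ξ c)) * (ξ t - ξ c) =
            ((ξ d - ξ c) * (η t - η c) - (η d - η c) * (ξ t - ξ c)) * (ξ w - ξ c) := by
          linear_combination (ξ d - ξ c) * hlt
        have k1 : 0 ≤ ((ξ d - ξ c) * (η t - η c) - (η d - η c) * (ξ t - ξ c)) * (ξ w - ξ c) :=
          mul_nonneg hpos'.le (by linarith)
        have k2 : ((ξ d - ξ c) * (η w - η c) - (η d - η c) * (ξ w - ξ c)) * (ξ t - ξ c) < 0 :=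
          mul_neg_of_neg_of_pos (by linarith) (by linarith)
        linarith
      · intro w hw
        rw [hg1 w ⟨hsegH hw, hsegl h1 h2 h3' h4' hU' hV' w hw⟩
          (hsegl h1 h2 h3 h4 (e1 ▸ hU) (e2 ▸ hV) w hw), hgf₀ hw]
      · rw [abs_of_pos (by linarith)] at b3
        push_cast at hn
        linarith

/-- If no triangle has all its edges of positive slope in the coordinates `ξ`, `η`, then a half-
rectangle whose hypotenuse is an edge of positive slope immerses. -/
lemma exists_halfRectangle [T2Space S] {ξ η : ℂ →L[ℝ] ℝ}
    (hinj : ∀ w, ξ w = 0 → η w = 0 → w = 0) {N : ℂ} (hN : ξ N = 0) (hN' : η N = 1)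
    (hne : ∀ e, ξ (τ.edge e).hol * η (τ.edge e).hol ≠ 0)
    (hmono : ∀ T, ¬ ∀ i, 0 < ξ (τ.edge (τ.side T i)).hol * η (τ.edge (τ.side T i)).hol)
    {a b : ℂ} {e : τ.Edge} {f : ℂ → S} (hU : 0 < ξ (b - a)) (hV : 0 < η (b - a))
    (hab : b - a = (τ.edge e).hol ∨ b - a = -(τ.edge e).hol) (hf : (τ.edge e).Develops f a b) :
    ∃ g, X.IsHalfTranslationOn g (halfRectangle ξ η a b) ∧ Set.EqOn g f (segment ℝ a b) := by
  have := τ.finite_edge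
  -- Finitely many edges, none parallel to an axis, give a uniform step.
  obtain ⟨δ, hδ, hξη⟩ : ∃ δ > 0, ∀ e, δ ≤ min |ξ (τ.edge e).hol| |η (τ.edge e).hol| := by
    have : Nonempty τ.Edge := ⟨e⟩
    obtain ⟨e₀, he₀⟩ := Finite.exists_min fun e => min |ξ (τ.edge e).hol| |η (τ.edge e).hol|
    exact ⟨_, lt_min (abs_pos.mpr (left_ne_zero_of_mul (hne e₀)))
      (abs_pos.mpr (right_ne_zero_of_mul (hne e₀))), he₀⟩
  obtain ⟨n, hn⟩ := exists_nat_ge (((η b - η a) + (ξ b - ξ a)) / δ)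
  have hseg : ∀ w ∈ halfRectangle ξ η a b, cross ξ η (b - a) w ≤ cross ξ η (b - a) a →
      w ∈ segment ℝ a b := fun w hw hle =>
    mem_segment_of_cross_eq hinj hU hV (le_antisymm hle hw.2.2) hw.1 hw.2.1
  -- The initial front is the hypotenuse itself: the region before it is a segment with empty
  -- interior, so only continuity is at stake.
  refine τ.exists_halfRectangle_of_developed hinj hN hN' (fun e => (hξη e).trans (min_le_left _ _))
    (fun e => (hξη e).trans (min_le_right _ _)) hδ hmono hU hV n a b e f f le_rfl le_rfl le_rfl
    le_rfl hU hV hab hf ⟨?_, ?_⟩ (fun _ _ _ => rfl) (fun _ _ => rfl) ((div_le_iff₀ hδ).mp hn)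
  · have hcont : ContinuousOn f (segment ℝ a b) := by
      have key : ∀ {a b : ℂ}, 0 < |ξ (b - a)| → (∀ t ∈ Set.Icc (0 : ℝ) 1,
          f (AffineMap.lineMap a b t) = (τ.edge e).path t) → ContinuousOn f (segment ℝ a b) := by
        intro a b hU h
        have hval : ∀ t : ℝ, (ξ (AffineMap.lineMap a b t) - ξ a) / ξ (b - a) = t := fun t => by
          have := abs_pos.mp hU
          rw [AffineMap.lineMap_apply, vsub_eq_sub, vadd_eq_add, map_add, map_smul, smul_eq_mul]
          field_simp
          ring
        have h1 : ContinuousOn (fun w => (τ.edge e).path ((ξ w - ξ a) / ξ (b - a)))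
            (segment ℝ a b) := by
          refine (τ.edge e).continuousOn.comp (by fun_prop) ?_
          rw [segment_eq_image_lineMap]
          rintro _ ⟨s, hs, rfl⟩
          simp only [hval]
          exact hs
        refine h1.congr ?_
        rw [segment_eq_image_lineMap]
        rintro _ ⟨s, hs, rfl⟩
        simp only [hval]
        exact h s hs
      rcases hf with hf | hf
      · exact key (abs_pos.mpr hU.ne') hf
      · rw [segment_symm]
        refine key (abs_pos.mpr ?_) hf
        rw [← neg_sub, map_neg]
        exact neg_ne_zero.mpr hU.ne'
    exact hcont.mono fun w hw => hseg w hw.1 hw.2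
  · intro w hw
    have hl0 : cross ξ η (b - a) ≠ 0 := by
      intro h
      have := congrArg (fun l : ℂ →L[ℝ] ℝ => l N) h
      simp only [cross_apply, hN, hN', zero_apply] at this
      linarith
    have i1 := lt_of_mem_interior hl0 (fun v hv => hv.1.2.2) hw
    have i2 := gt_of_mem_interior hl0 (fun v hv => hv.2) hw
    linarith

/-- If no triangle has all its edges of positive slope in the coordinates `ξ`, `η`, then a rectangle
whose diagonal is an edge of positive slope immerses. -/
lemma exists_rectangle [T2Space S] {ξ η : ℂ →L[ℝ] ℝ}
    (hinj : ∀ w, ξ w = 0 → η w = 0 → w = 0) {N : ℂ} (hN : ξ N = 0) (hN' : η N = 1)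
    (hne : ∀ e, ξ (τ.edge e).hol * η (τ.edge e).hol ≠ 0)
    (hmono : ∀ T, ¬ ∀ i, 0 < ξ (τ.edge (τ.side T i)).hol * η (τ.edge (τ.side T i)).hol)
    {e : τ.Edge} (hU : 0 < ξ (τ.edge e).hol) (hV : 0 < η (τ.edge e).hol) :
    ∃ g, X.IsHalfTranslationOn g
      {w | (0 ≤ ξ w ∧ ξ w ≤ ξ (τ.edge e).hol) ∧ 0 ≤ η w ∧ η w ≤ η (τ.edge e).hol} ∧
      ∀ t ∈ Set.Icc (0 : ℝ) 1, g (AffineMap.lineMap 0 (τ.edge e).hol t) = (τ.edge e).path t := by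
  set h := (τ.edge e).hol
  set K := {w | (0 ≤ ξ w ∧ ξ w ≤ ξ h) ∧ 0 ≤ η w ∧ η w ≤ η h} with hK
  obtain ⟨f, hf⟩ : ∃ f : ℂ → S,
      ∀ t ∈ Set.Icc (0 : ℝ) 1, f (AffineMap.lineMap 0 h t) = (τ.edge e).path t := by
    refine ⟨fun w => (τ.edge e).path (ξ w / ξ h), fun t ht => ?_⟩
    simp only
    congr 1
    rw [AffineMap.lineMap_apply, vsub_eq_sub, vadd_eq_add, map_add, map_smul, smul_eq_mul,
      map_zero, sub_zero]
    field_simp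
    ring
  have hfd : (τ.edge e).Develops f 0 h := Or.inl hf
  obtain ⟨g₂, hg2, hgf2⟩ := τ.exists_halfRectangle hinj hN hN' hne hmono (a := 0) (b := h)
    (by rwa [sub_zero]) (by rwa [sub_zero]) (Or.inl (by rw [sub_zero])) hfd
  -- Negating both coordinates and reversing the diagonal gives the half below it.
  obtain ⟨g₁, hg1, hgf1⟩ := τ.exists_halfRectangle (ξ := -ξ) (η := -η) (N := -N)
    (fun w h1 h2 => hinj w (neg_eq_zero.mp h1) (neg_eq_zero.mp h2)) (by simp [hN]) (by simp [hN'])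
    (by simpa using hne) (by simpa using hmono) (a := h) (b := 0)
    (by simpa using hU) (by simpa using hV) (Or.inr (by rw [zero_sub])) hfd.symm
  set l := cross ξ η h with hl
  have hl0 : l ≠ 0 := by
    intro h
    have := congrArg (fun l : ℂ →L[ℝ] ℝ => l N) h
    simp only [hl, cross_apply, hN, hN', zero_apply] at this
    linarith
  have hξ0 : ξ ≠ 0 := by rintro rfl; simp at hU
  have hη0 : η ≠ 0 := by rintro rfl; simp at hV
  have hcr : ∀ w, l w = 0 → cross ξ η (h - 0) w = cross ξ η (h - 0) 0 := fun w hw => by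
    rw [sub_zero, map_zero]; exact hw
  have hseg : ∀ w ∈ K, l w = 0 → w ∈ segment ℝ 0 h := fun w hw hlw =>
    mem_segment_of_cross_eq hinj (by rwa [sub_zero]) (by rwa [sub_zero]) (hcr w hlw)
      (by rw [map_zero]; exact hw.1.1) hw.2.2
  have hgf1' : ∀ w ∈ segment ℝ 0 h, g₁ w = f w := fun w hw => hgf1 (segment_symm ℝ 0 h ▸ hw)
  have hglue : ∃ g : ℂ → S, X.IsHalfTranslationOn g K ∧ (∀ w ∈ K, l w ≤ 0 → g w = g₁ w) ∧
      ∀ w ∈ K, 0 ≤ l w → g w = g₂ w := by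
    refine IsHalfTranslationOn.glue hl0 (hg1.mono ?_) (hg2.mono ?_) ?_ ?_
    · rintro w ⟨hw, hlw⟩
      simp only [Set.mem_ofPred_eq, hl, cross_apply] at hlw
      simp only [halfRectangle, cross_apply, Set.mem_ofPred_eq, neg_apply, map_sub, map_zero]
      exact ⟨by linarith [hw.1.2], by linarith [hw.2.1], by nlinarith⟩
    · rintro w ⟨hw, hlw⟩
      simp only [Set.mem_ofPred_eq, hl, cross_apply] at hlw
      simp only [halfRectangle, cross_apply, Set.mem_ofPred_eq, map_sub, map_zero]
      exact ⟨hw.1.1, hw.2.2, by linarith⟩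
    · intro w hw hlw
      rw [hgf1' w (hseg w hw hlw), hgf2 (hseg w hw hlw)]
    · intro w hw hlw
      rw [hgf1' w (hseg w (interior_subset hw) hlw)]
      have i1 := lt_of_mem_interior hξ0 (fun v hv => hv.1.1) hw
      have i2 := gt_of_mem_interior hη0 (fun v hv => hv.2.2) hw
      obtain ⟨s, hs, rfl⟩ := exists_lineMap_of_cross_eq hinj (by rwa [sub_zero]) (by rwa [sub_zero])
        (hcr w hlw) (by rwa [map_zero]) i2
      exact SaddleConnection.notMem_of_mem_inner (hfd.mem_inner hs)
  obtain ⟨g, hg, hgg1, -⟩ := hglue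
  refine ⟨g, hg, fun t ht => ?_⟩
  have hmem : AffineMap.lineMap 0 h t ∈ segment ℝ 0 h := by
    rw [segment_eq_image_lineMap]; exact ⟨t, ht, rfl⟩
  rw [← hf t ht, ← hgf1' _ hmem]
  have hval : (AffineMap.lineMap 0 h t : ℂ) = t • h := by
    rw [AffineMap.lineMap_apply, vsub_eq_sub, vadd_eq_add, sub_zero, add_zero]
  rw [hval]
  refine hgg1 _ ?_ ?_
  · simp only [hK, Set.mem_ofPred_eq, map_smul, smul_eq_mul]
    refine ⟨⟨mul_nonneg ht.1 hU.le, ?_⟩, mul_nonneg ht.1 hV.le, ?_⟩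
    · nlinarith [ht.2]
    · nlinarith [ht.2]
  · rw [map_smul, hl, cross_apply, smul_eq_mul]
    nlinarith

/-- The slope conditions on a veering triangulation, in terms of the products of the coordinates of
the holonomies. -/
lemma IsVeering.slopes {τ : X.StraightTriangulation} (h : τ.IsVeering) :
    (∀ e, (τ.edge e).hol.re * (τ.edge e).hol.im ≠ 0) ∧
      ∀ (s : ℝ) T, ¬ ∀ i, 0 < s * ((τ.edge (τ.side T i)).hol.re * (τ.edge (τ.side T i)).hol.im) := by
  obtain ⟨col, hm, hT, -⟩ := h
  have hred : ∀ e, col e = Colour.red → 0 < (τ.edge e).hol.re * (τ.edge e).hol.im := fun e he => by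
    obtain ⟨-, h2⟩ := (hm e).1 he
    rcases div_pos_iff.mp h2 with ⟨h3, h4⟩ | ⟨h3, h4⟩
    · exact mul_pos h4 h3
    · exact mul_pos_of_neg_of_neg h4 h3
  have hblue : ∀ e, col e = Colour.blue → (τ.edge e).hol.re * (τ.edge e).hol.im < 0 :=
    fun e he => by
    obtain ⟨-, h2⟩ := (hm e).2 he
    rcases div_neg_iff.mp h2 with ⟨h3, h4⟩ | ⟨h3, h4⟩
    · exact mul_neg_of_neg_of_pos h4 h3
    · exact mul_neg_of_pos_of_neg h4 h3
  refine ⟨fun e => ?_, fun s T hcon => ?_⟩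
  · cases he : col e
    · exact (hred e he).ne'
    · exact (hblue e he).ne
  · rcases le_total 0 s with hs | hs
    · refine hT T ⟨Colour.red, fun i => ?_⟩
      cases he : col (τ.side T i)
      · rfl
      · exact absurd (hcon i) (not_lt.mpr (mul_nonpos_of_nonneg_of_nonpos hs (hblue _ he).le))
    · refine hT T ⟨Colour.blue, fun i => ?_⟩
      cases he : col (τ.side T i)
      · exact absurd (hcon i) (not_lt.mpr (mul_nonpos_of_nonpos_of_nonneg hs (hred _ he).le))
      · rfl

theorem IsVeering.isDiagonalOfImmersedRectangle [T2Space S] {τ : X.StraightTriangulation}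
    (h : τ.IsVeering) (e : τ.Edge) : (τ.edge e).IsDiagonalOfImmersedRectangle := by
  obtain ⟨hne, hmono⟩ := h.slopes
  have hre : (τ.edge e).hol.re ≠ 0 := left_ne_zero_of_mul (hne e)
  have him : (τ.edge e).hol.im ≠ 0 := right_ne_zero_of_mul (hne e)
  have hsgn : ∀ x : ℝ, x ≠ 0 → ∃ σ : ℝ, (σ = 1 ∨ σ = -1) ∧ 0 < σ * x := by
    intro x hx
    rcases hx.lt_or_gt with hx | hx
    · exact ⟨-1, Or.inr rfl, by linarith⟩
    · exact ⟨1, Or.inl rfl, by linarith⟩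
  obtain ⟨σ, hσ, hσ'⟩ := hsgn _ hre
  obtain ⟨ρ, hρ, hρ'⟩ := hsgn _ him
  have hσ0 : σ ≠ 0 := by rintro rfl; simp at hσ'
  have hρ0 : ρ ≠ 0 := by rintro rfl; simp at hρ'
  have hprod : ∀ v : ℂ, (σ • Complex.reCLM) v * (ρ • Complex.imCLM) v =
      (σ * ρ) * (v.re * v.im) := fun v => by
    simp; ring
  -- The signs `σ` and `ρ` move the holonomy to the open first quadrant; the slope condition then
  -- becomes the one with factor `σ * ρ`.
  obtain ⟨g, hg, hgp⟩ := τ.exists_rectangle (ξ := σ • Complex.reCLM) (η := ρ • Complex.imCLM)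
    (fun w h1 h2 => by
      apply Complex.ext
      · simpa [hσ0] using h1
      · simpa [hρ0] using h2) (N := ρ⁻¹ • Complex.I) (by simp) (by simp [hρ0])
    (fun e => by
      rw [hprod]
      exact mul_ne_zero (mul_ne_zero hσ0 hρ0) (hne e))
    (fun T => by simpa only [hprod] using hmono (σ * ρ) T) (e := e) hσ' hρ'
  have key : ∀ {σ x y : ℝ}, (σ = 1 ∨ σ = -1) → 0 < σ * y →
      x ∈ Set.uIcc 0 y → 0 ≤ σ * x ∧ σ * x ≤ σ * y := by
    rintro σ x y (rfl | rfl) hy hx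
    · rw [Set.uIcc_of_le (by linarith)] at hx
      exact ⟨by linarith [hx.1], by linarith [hx.2]⟩
    · rw [Set.uIcc_of_ge (by linarith)] at hx
      exact ⟨by linarith [hx.2], by linarith [hx.1]⟩
  have hg' := hg.mono (L := Set.uIcc (0 : ℂ).re (τ.edge e).hol.re ×ℂ
    Set.uIcc (0 : ℂ).im (τ.edge e).hol.im) fun w hw =>
      ⟨key hσ hσ' hw.1, key hρ hρ' hw.2⟩
  exact ⟨0, (τ.edge e).hol, hre.symm, him.symm, g, hg'.1, hg'.2, hgp⟩

end StraightTriangulation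

/-! ### Axis-parallel rectangles in the plane -/

lemma convex_reProdIm {s t : Set ℝ} (hs : Convex ℝ s) (ht : Convex ℝ t) : Convex ℝ (s ×ℂ t) :=
  (hs.linear_preimage Complex.reCLM.toLinearMap).inter
    (ht.linear_preimage Complex.imCLM.toLinearMap)

lemma mem_interior_uIcc {a b x : ℝ} (h : (x - a) * (x - b) < 0) :
    x ∈ interior (Set.uIcc a b) := by
  rw [Set.uIcc, interior_Icc]
  rcases mul_neg_iff.mp h with ⟨h1, h2⟩ | ⟨h1, h2⟩
  · exact ⟨inf_lt_iff.mpr (Or.inl (by linarith)), lt_sup_iff.mpr (Or.inr (by linarith))⟩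
  · exact ⟨inf_lt_iff.mpr (Or.inr (by linarith)), lt_sup_iff.mpr (Or.inl (by linarith))⟩

/-- The closed rectangle with sides parallel to the axes and opposite corners `p` and `q`. -/
def rectangle (p q : ℂ) : Set ℂ := Set.uIcc p.re q.re ×ℂ Set.uIcc p.im q.im

lemma convex_rectangle (p q : ℂ) : Convex ℝ (rectangle p q) :=
  convex_reProdIm (convex_uIcc _ _) (convex_uIcc _ _)

lemma mem_interior_rectangle {p q w : ℂ} (h1 : (w.re - p.re) * (w.re - q.re) < 0)
    (h2 : (w.im - p.im) * (w.im - q.im) < 0) : w ∈ interior (rectangle p q) := by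
  rw [rectangle, Complex.interior_reProdIm]
  exact ⟨mem_interior_uIcc h1, mem_interior_uIcc h2⟩

lemma lineMap_half_mem_interior_rectangle {p q : ℂ} (h1 : p.re ≠ q.re) (h2 : p.im ≠ q.im) :
    AffineMap.lineMap p q (1 / 2 : ℝ) ∈ interior (rectangle p q) := by
  have k1 : 0 < (p.re - q.re) ^ 2 := by
    have := sub_ne_zero.mpr h1
    positivity
  have k2 : 0 < (p.im - q.im) ^ 2 := by
    have := sub_ne_zero.mpr h2
    positivity
  have e : (AffineMap.lineMap p q (1 / 2 : ℝ) : ℂ) = (1 / 2 : ℝ) • (q - p) + p := by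
    rw [AffineMap.lineMap_apply, vsub_eq_sub, vadd_eq_add]
  rw [e]
  apply mem_interior_rectangle
  · rw [Complex.add_re, Complex.smul_re, Complex.sub_re, smul_eq_mul]
    nlinarith
  · rw [Complex.add_im, Complex.smul_im, Complex.sub_im, smul_eq_mul]
    nlinarith

lemma left_mem_rectangle (p q : ℂ) : p ∈ rectangle p q :=
  ⟨Set.left_mem_uIcc, Set.left_mem_uIcc⟩

lemma right_mem_rectangle (p q : ℂ) : q ∈ rectangle p q :=
  ⟨Set.right_mem_uIcc, Set.right_mem_uIcc⟩

namespace SaddleConnection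

variable {γ : X.SaddleConnection}

lemma IsDiagonalOfImmersedRectangle.exists_rectangle (h : γ.IsDiagonalOfImmersedRectangle) :
    ∃ p q : ℂ, p.re ≠ q.re ∧ p.im ≠ q.im ∧ (q - p = γ.hol ∨ q - p = -γ.hol) ∧ ∃ f : ℂ → S,
      X.IsHalfTranslationOn f (rectangle p q) ∧
      ∀ t ∈ Set.Icc (0 : ℝ) 1, f (AffineMap.lineMap p q t) = γ.path t := by
  obtain ⟨p, q, h1, h2, f, hf, hf', hp⟩ := h
  have hfR : X.IsHalfTranslationOn f (rectangle p q) := ⟨hf, hf'⟩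
  exact ⟨p, q, h1, h2, hfR.sub_eq_hol (convex_rectangle p q)
    ⟨_, lineMap_half_mem_interior_rectangle h1 h2⟩ (left_mem_rectangle p q)
    (right_mem_rectangle p q) γ hp, f, hfR, hp⟩

lemma IsDiagonalOfImmersedRectangle.re_mul_im_ne_zero (h : γ.IsDiagonalOfImmersedRectangle) :
    γ.hol.re * γ.hol.im ≠ 0 := by
  obtain ⟨p, q, h1, h2, h3, -⟩ := h.exists_rectangle
  have k1 : q.re - p.re ≠ 0 := sub_ne_zero.mpr h1.symm
  have k2 : q.im - p.im ≠ 0 := sub_ne_zero.mpr h2.symm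
  rcases h3 with h3 | h3
  · rw [← h3]
    exact mul_ne_zero k1 k2
  · rw [← neg_eq_iff_eq_neg.mpr h3, Complex.neg_re, Complex.neg_im, neg_mul_neg]
    exact mul_ne_zero k1 k2

end SaddleConnection

/-! ### Veering from immersed rectangles -/

namespace StraightTriangulation

variable (τ : X.StraightTriangulation)

/-- A half-translation map of an open convex region that agrees with the map of a face along a side
agrees with it on the part of the face in that region. -/
lemma eqOn_faceMap [T2Space S] {T : τ.Face} {A B : ℂ} (hA : A ∈ τ.triangle T)
    (hB : B ∈ τ.triangle T) (hAB : A ≠ B) {γ : X.SaddleConnection}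
    (hT : ∀ t ∈ Set.Icc (0 : ℝ) 1, τ.faceMap T (AffineMap.lineMap A B t) = γ.path t) {U : Set ℂ}
    (hU : IsOpen U) (hUc : Convex ℝ U) {f : ℂ → S} (hf : ∀ w ∈ U, X.IsHalfTranslationAt f w)
    (hfγ : ∀ t ∈ Set.Icc (0 : ℝ) 1, f (AffineMap.lineMap A B t) = γ.path t)
    (hM : AffineMap.lineMap A B (1 / 2 : ℝ) ∈ U) :
    Set.EqOn f (τ.faceMap T) (τ.triangle T ∩ U) := by
  have hhalf : (1 / 2 : ℝ) ∈ Set.Icc (0 : ℝ) 1 := by norm_num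
  set M : ℂ := AffineMap.lineMap A B (1 / 2 : ℝ)
  have hMT : M ∈ τ.triangle T := (τ.convex_triangle T).lineMap_mem hA hB hhalf
  have hcl : τ.triangle T ⊆ closure (interior (τ.triangle T)) := by
    rw [(τ.convex_triangle T).closure_interior_eq_closure_of_nonempty_interior
      (τ.interior_triangle_nonempty T)]
    exact subset_closure
  set W := interior (τ.triangle T) ∩ U with hW
  have hclW : ∀ w ∈ τ.triangle T, w ∈ U → w ∈ closure W := fun w hw hwU => by
    rw [hW, Set.inter_comm]
    exact hU.inter_closure ⟨hwU, hcl hw⟩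
  have hWT : W ⊆ τ.triangle T := Set.inter_subset_left.trans interior_subset
  obtain ⟨φ, hφ, ε, hε, hev⟩ := γ.straight (1 / 2) (by norm_num)
  have hMφ : γ.path (1 / 2) ∈ φ.source := hev.self_of_nhds.1
  have hpath := hev.mono fun s hs => hs.2
  obtain ⟨ε₁, c₁, -, ev₁⟩ := (hf M hM).eventually_chart_eq hφ (hfγ _ hhalf ▸ hMφ)
  obtain ⟨ε₂, c₂, -, ev₂⟩ := (τ.isHalfTranslationOn_faceMap T).eventually_chart_eq
    (τ.convex_triangle T) (τ.interior_triangle_nonempty T) hMT hφ (hT _ hhalf ▸ hMφ)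
  have d₁ := mul_sub_eq_mul_hol (K := τ.triangle T) (τ.convex_triangle T) hA hB hfγ hpath
    (ev₁.filter_mono nhdsWithin_le_nhds)
  have d₂ := mul_sub_eq_mul_hol (τ.convex_triangle T) hA hB hT hpath (ev₂.mono fun v hv => hv.2)
  -- In one chart both maps send the direction `B - A` to the same vector, which fixes the sign.
  obtain rfl : ε₁ = ε₂ := mul_right_cancel₀ (sub_ne_zero.mpr hAB.symm) (d₁.trans d₂.symm)
  obtain rfl : c₁ = c₂ := by
    have h1 := ev₁.self_of_nhds
    have h2 := (ev₂.self_of_nhdsWithin hMT).2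
    rw [hfγ _ hhalf] at h1
    rw [hT _ hhalf, h1] at h2
    exact add_left_cancel h2
  have hnear : ∀ᶠ v in 𝓝[τ.triangle T] M, f v = τ.faceMap T v := by
    have hsrc : ∀ᶠ v in 𝓝 M, f v ∈ φ.source := (hf M hM).continuousAt.eventually
      (φ.open_source.mem_nhds (hfγ _ hhalf ▸ hMφ))
    filter_upwards [ev₁.filter_mono nhdsWithin_le_nhds, ev₂, hsrc.filter_mono nhdsWithin_le_nhds]
      with v h1 h2 h3
    exact φ.injOn h3 h2.1 (h1.trans h2.2.symm)
  -- The midpoint may be on the boundary of the triangle, so continuation starts at a nearby point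
  -- of the open set `W`.
  obtain ⟨u, hu, huW⟩ : ∃ u, f =ᶠ[𝓝 u] τ.faceMap T ∧ u ∈ W := by
    have hne : (𝓝[W] M).NeBot := mem_closure_iff_nhdsWithin_neBot.mp (hclW M hMT hM)
    have h1 := (eventually_eventually_nhdsWithin.mpr hnear).filter_mono (nhdsWithin_mono M hWT)
    obtain ⟨u, hu, huW⟩ := (h1.and self_mem_nhdsWithin).exists
    refine ⟨u, ?_, huW⟩
    rwa [nhdsWithin_eq_nhds.mpr (mem_interior_iff_mem_nhds.mp huW.1)] at hu
  have hEq : Set.EqOn f (τ.faceMap T) W :=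
    eqOn_of_eventuallyEq ((τ.convex_triangle T).interior.inter hUc).isPreconnected
      (fun w hw => hf w hw.2) (fun w hw => τ.isHalfTranslationAt_faceMap T w hw.1) huW hu
  refine hEq.of_subset_closure (fun w hw => (hf w hw.2).continuousAt.continuousWithinAt)
    ((τ.continuousOn_faceMap T).mono Set.inter_subset_left) (fun w hw => ⟨hWT hw, hw.2⟩) ?_
  exact fun w hw => hclW w hw.1 hw.2

/-- No vertex of a face lies strictly between the other two in both coordinates, if the side between
those is a diagonal of an immersed rectangle. -/
lemma not_between_of_isDiagonal [T2Space S] {T : τ.Face} {j : Fin 3}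
    (hd : (τ.edge (τ.side T (j + 1))).IsDiagonalOfImmersedRectangle)
    (hre : ((τ.vert T j).re - (τ.vert T (j + 1)).re) *
      ((τ.vert T j).re - (τ.vert T (j + 2)).re) < 0)
    (him : ((τ.vert T j).im - (τ.vert T (j + 1)).im) *
      ((τ.vert T j).im - (τ.vert T (j + 2)).im) < 0) : False := by
  obtain ⟨p, q, hpq, hpq', hhol, f, hf, hfp⟩ := hd.exists_rectangle
  set m := τ.vert T j
  have hj1 : j + 1 + 1 = j + 2 := by rw [add_assoc]; rfl
  obtain ⟨A, B, hA, hB, hAB, hre', him'⟩ : ∃ A B, A ∈ τ.triangle T ∧ B ∈ τ.triangle T ∧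
      (∀ t ∈ Set.Icc (0 : ℝ) 1, τ.faceMap T (AffineMap.lineMap A B t) =
        (τ.edge (τ.side T (j + 1))).path t) ∧
      (m.re - A.re) * (m.re - B.re) < 0 ∧ (m.im - A.im) * (m.im - B.im) < 0 := by
    have := τ.develops_side T (j + 1)
    rw [hj1] at this
    rcases this with h | h
    · exact ⟨_, _, τ.vert_mem_triangle T _, τ.vert_mem_triangle T _, h, hre, him⟩
    · exact ⟨_, _, τ.vert_mem_triangle T _, τ.vert_mem_triangle T _, h, by linarith, by linarith⟩
  have hhol' := (τ.isHalfTranslationOn_faceMap T).sub_eq_hol (τ.convex_triangle T)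
    (τ.interior_triangle_nonempty T) hA hB _ hAB
  obtain ⟨ε, hε, hεpq⟩ : ∃ ε : ℝ, (ε = 1 ∨ ε = -1) ∧ q - p = ε * (B - A) := by
    rcases hhol with h | h <;> rcases hhol' with h' | h' <;> rw [h, h']
    · exact ⟨1, Or.inl rfl, by simp⟩
    · exact ⟨-1, Or.inr rfl, by simp⟩
    · exact ⟨-1, Or.inr rfl, by simp⟩
    · exact ⟨1, Or.inl rfl, by simp⟩
  have hεc : (ε : ℂ) = 1 ∨ (ε : ℂ) = -1 := by
    rcases hε with rfl | rfl <;> simp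
  have hεε : ε * ε = 1 := by rcases hε with rfl | rfl <;> norm_num
  set k := p - ε * A with hk
  have kA : ε * A + k = p := by rw [hk]; ring
  have kB : ε * B + k = q := by rw [hk]; linear_combination -hεpq
  set U := (fun u : ℂ => ε * u + k) ⁻¹' interior (rectangle p q) with hUdef
  have hUo : IsOpen U := isOpen_interior.preimage (by fun_prop)
  have hmU : m ∈ U := by
    apply mem_interior_rectangle
    · have : (ε * m + k).re - p.re = ε * (m.re - A.re) := by
        rw [← kA]; simp; ring
      rw [this]
      have : (ε * m + k).re - q.re = ε * (m.re - B.re) := by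
        rw [← kB]; simp; ring
      rw [this]
      linear_combination hre' + (m.re - A.re) * (m.re - B.re) * hεε
    · have : (ε * m + k).im - p.im = ε * (m.im - A.im) := by
        rw [← kA]; simp; ring
      rw [this]
      have : (ε * m + k).im - q.im = ε * (m.im - B.im) := by
        rw [← kB]; simp; ring
      rw [this]
      linear_combination him' + (m.im - A.im) * (m.im - B.im) * hεε
  have hfU : ∀ w ∈ U, X.IsHalfTranslationAt (fun u => f (ε * u + k)) w := fun w hw =>
    IsHalfTranslationAt.comp_affine hεc (hf.2 _ hw)
  have hne : A ≠ B := by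
    rintro rfl
    rw [sub_self, mul_zero] at hεpq
    exact hpq (congrArg Complex.re (sub_eq_zero.mp hεpq)).symm
  have hEq := τ.eqOn_faceMap hA hB hne hAB hUo
    (convex_affine_preimage (convex_rectangle p q).interior ε k) hfU
    (fun t ht => by simp only [mul_lineMap_add, kA, kB]; exact hfp t ht)
    (by
      simp only [hUdef, Set.mem_preimage, mul_lineMap_add, kA, kB]
      exact lineMap_half_mem_interior_rectangle hpq hpq')
  -- The vertex `m` is marked through the face map but unmarked through the interior of the
  -- rectangle.
  have hm' : f (ε * m + k) = τ.faceMap T m := hEq ⟨τ.vert_mem_triangle T j, hmU⟩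
  have hZ : f (ε * m + k) ∉ X.Z := (hfU m hmU).notMem
  rw [hm'] at hZ
  exact hZ (τ.develops_side T j).isEndpoint_left.mem

/-- The product of the coordinates does not see the sign ambiguity of the holonomy. -/
lemma re_mul_im_vert_sub (T : τ.Face) (i : Fin 3) :
    (τ.vert T (i + 1) - τ.vert T i).re * (τ.vert T (i + 1) - τ.vert T i).im =
      (τ.edge (τ.side T i)).hol.re * (τ.edge (τ.side T i)).hol.im := by
  rcases τ.vert_sub_vert T i with h | h <;> rw [h]
  rw [Complex.neg_re, Complex.neg_im, neg_mul_neg]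

/-- If all edges are diagonals of immersed rectangles, then no triangle has all its edges of slopes
of the same sign. -/
lemma not_monochromatic_face [T2Space S]
    (hd : ∀ e, (τ.edge e).IsDiagonalOfImmersedRectangle) (s : ℝ) (T : τ.Face) :
    ¬ ∀ i, 0 < s * ((τ.edge (τ.side T i)).hol.re * (τ.edge (τ.side T i)).hol.im) := by
  intro h
  have hpos : ∀ i, 0 < s * (((τ.vert T (i + 1)).re - (τ.vert T i).re) *
      ((τ.vert T (i + 1)).im - (τ.vert T i).im)) := fun i => by
    have := h i
    rwa [← τ.re_mul_im_vert_sub T i] at this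
  have hmid : ∀ j, 0 ≤ ((τ.vert T j).re - (τ.vert T (j + 1)).re) *
      ((τ.vert T j).re - (τ.vert T (j + 2)).re) := by
    intro j
    by_contra hcon
    push Not at hcon
    refine τ.not_between_of_isDiagonal (hd _) hcon ?_
    have h1 := hpos j
    have h2 := hpos (j + 2)
    have hj2 : j + 2 + 1 = j := by rw [add_assoc]; exact add_zero j
    rw [hj2] at h2
    -- The product is `s ^ 2` times the two betweenness expressions at `j`, so these have the same
    -- sign.
    have h3 := mul_pos h1 h2
    by_contra hcon'
    push Not at hcon'
    have h4 := mul_nonneg (mul_self_nonneg s) (mul_nonneg (neg_nonneg.mpr hcon.le) hcon')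
    linarith
  have h0 := hmid 0
  have h1 := hmid 1
  have h2 := hmid 2
  have p0 := hpos 0
  have p1 := hpos 1
  have p2 := hpos 2
  have i1 : (0 : Fin 3) + 1 = 1 := rfl
  have i2 : (0 : Fin 3) + 2 = 2 := rfl
  have i3 : (1 : Fin 3) + 1 = 2 := rfl
  have i4 : (1 : Fin 3) + 2 = 0 := rfl
  have i5 : (2 : Fin 3) + 1 = 0 := rfl
  have i6 : (2 : Fin 3) + 2 = 1 := rfl
  simp only [i1, i2, i3, i4, i5, i6] at h0 h1 h2 p0 p1 p2
  have n0 := left_ne_zero_of_mul (right_ne_zero_of_mul p0.ne')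
  have n1 := left_ne_zero_of_mul (right_ne_zero_of_mul p1.ne')
  have n2 := left_ne_zero_of_mul (right_ne_zero_of_mul p2.ne')
  -- Of three distinct real parts one is strictly between the others.
  rcases lt_or_gt_of_ne n0 with m0 | m0 <;> rcases lt_or_gt_of_ne n1 with m1 | m1 <;>
    rcases lt_or_gt_of_ne n2 with m2 | m2 <;> nlinarith

/-- The closed faces cover the surface minus the marked points. -/
lemma exists_mem_image_triangle [T2Space S] {y : S} (hy : y ∉ X.Z) :
    ∃ T, y ∈ τ.faceMap T '' τ.triangle T := by
  have hcov : y ∈ X.Z ∪ (⋃ e, (τ.edge e).inner) ∪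
    (⋃ T, τ.faceMap T '' interior (convexHull ℝ (Set.range (τ.vert T)))) := by
    rw [τ.cover]; trivial
  rcases hcov with (h | h) | h
  · exact absurd h hy
  · obtain ⟨e, t, ht, rfl⟩ := Set.mem_iUnion.mp h
    have hl0 : cross Complex.reCLM Complex.imCLM (τ.edge e).hol ≠ 0 := by
      intro h0
      -- On the holonomy turned by a right angle the functional takes the value `re ^ 2 + im ^ 2`.
      have h1 := congrArg (fun l : ℂ →L[ℝ] ℝ => l (Complex.I * (τ.edge e).hol)) h0
      simp [cross_apply] at h1
      have hre : (τ.edge e).hol.re = 0 := by nlinarith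
      have him : (τ.edge e).hol.im = 0 := by nlinarith
      exact (τ.edge e).hol_ne_zero (Complex.ext hre him)
    obtain ⟨T, j, A, B, hAB, -, hpath, -⟩ := τ.exists_adjacent_face e hl0
      (by rw [cross_apply]; ring)
    have hA : A ∈ τ.triangle T := by
      rcases hAB with ⟨rfl, -⟩ | ⟨rfl, -⟩ <;> exact τ.vert_mem_triangle T _
    have hB : B ∈ τ.triangle T := by
      rcases hAB with ⟨-, rfl⟩ | ⟨-, rfl⟩ <;> exact τ.vert_mem_triangle T _
    have ht' : t ∈ Set.Icc (0 : ℝ) 1 := ⟨ht.1.le, ht.2.le⟩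
    exact ⟨T, _, (τ.convex_triangle T).lineMap_mem hA hB ht', hpath t ht'⟩
  · obtain ⟨T, w, hw, rfl⟩ := Set.mem_iUnion.mp h
    exact ⟨T, w, interior_subset hw, rfl⟩

/-- Interior points go to unmarked points by the immersion property, and open sides go to open
edges. -/
lemma eq_vert_of_faceMap_mem {T : τ.Face} {w : ℂ} (hw : w ∈ τ.triangle T)
    (hZ : τ.faceMap T w ∈ X.Z) : ∃ j, w = τ.vert T j := by
  have hint : w ∉ interior (τ.triangle T) := fun h =>
    (τ.isHalfTranslationAt_faceMap T w h).notMem hZ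
  obtain ⟨i, t, ht, rfl⟩ := exists_side_of_notMem_interior (τ.nondegenerate T) hw hint
  rcases ht.1.eq_or_lt with rfl | h0
  · exact ⟨i, by simp⟩
  rcases ht.2.eq_or_lt with rfl | h1
  · exact ⟨i + 1, by simp⟩
  exact absurd hZ (SaddleConnection.notMem_of_mem_inner
    ((τ.develops_side T i).mem_inner ⟨h0, h1⟩))

/-- If no triangle has all its edges of slopes of the same sign, then no vertex has all its edges
of slopes of the same sign: otherwise the horizontal and vertical directions at the vertex would
not be covered. -/
lemma not_monochromatic_vertex [T2Space S] {s : ℝ} (hs : s ≠ 0)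
    (hT : ∀ T, ¬ ∀ i, 0 < s * ((τ.edge (τ.side T i)).hol.re * (τ.edge (τ.side T i)).hol.im))
    {z : S} (hz : z ∈ X.Z) :
    ¬ ∀ e, (τ.edge e).IsEndpoint z → 0 < s * ((τ.edge e).hol.re * (τ.edge e).hol.im) := by
  intro hmono
  have := τ.finite_face
  obtain ⟨k, hk, ψ, hzψ, hψ0, hψ⟩ := X.cone_point z hz
  have hface : ∀ᶠ y in 𝓝 z, ∀ T, y ∈ τ.faceMap T '' τ.triangle T → 0 ≤ s * (ψ y ^ k).im := by
    refine Filter.eventually_all.mpr fun T =>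
      eventually_of_isCompact (τ.isCompact_triangle T) (τ.continuousOn_faceMap T) ?_
    rintro w hw rfl
    obtain ⟨j, rfl⟩ := τ.eq_vert_of_faceMap_mem hw hz
    have hj2 : j + 2 + 1 = j := by rw [add_assoc]; exact add_zero j
    have hj1 : j + 1 + 1 = j + 2 := by rw [add_assoc]; rfl
    have s0 := hmono _ (τ.develops_side T j).isEndpoint_left
    have s2 := hmono (τ.side T (j + 2)) (by
      have := (τ.develops_side T (j + 2)).symm.isEndpoint_left
      rwa [hj2] at this)
    -- Two sides already have the sign of `s`, so the third cannot.
    have s1 : s * ((τ.edge (τ.side T (j + 1))).hol.re * (τ.edge (τ.side T (j + 1))).hol.im) ≤ 0 := by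
      by_contra hcon
      push Not at hcon
      refine hT T fun i => ?_
      rcases fin_three_eq i j with rfl | rfl | rfl <;> assumption
    rw [← τ.re_mul_im_vert_sub] at s0 s1 s2
    rw [hj2] at s2
    rw [hj1] at s1
    obtain ⟨β, h1, h2, h3, -⟩ := exists_barycentric (τ.nondegenerate T)
    filter_upwards [(τ.isHalfTranslationOn_faceMap T).eventually_cone_eq (τ.convex_triangle T)
      (τ.interior_triangle_nonempty T) hw hz hk hzψ hψ0 hψ, self_mem_nhdsWithin] with u hu huT
    have hβ : ∀ i, 0 ≤ β i u := by
      have : u ∈ {w | ∀ i, 0 ≤ β i w} := h3 ▸ huT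
      exact this
    have e1 := h1 u
    have e2 := h2 u
    rw [fin_three_sum _ j] at e1 e2
    have hre := congrArg Complex.re e2
    have him := congrArg Complex.im e2
    simp only [Complex.add_re, Complex.smul_re, Complex.add_im, Complex.smul_im, smul_eq_mul]
      at hre him
    simp only [Complex.sub_re, Complex.sub_im] at s0 s1 s2
    have e3 : β j u = 1 - β (j + 1) u - β (j + 2) u := by linarith
    rw [e3] at hre him
    have hx := hβ (j + 1)
    have hy := hβ (j + 2)
    generalize β (j + 1) u = x at *
    generalize β (j + 2) u = y at *
    have hre' : (u - τ.vert T j).re = x * ((τ.vert T (j + 1)).re - (τ.vert T j).re) +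
        y * ((τ.vert T (j + 2)).re - (τ.vert T j).re) := by
      rw [Complex.sub_re]; linarith
    have him' : (u - τ.vert T j).im = x * ((τ.vert T (j + 1)).im - (τ.vert T j).im) +
        y * ((τ.vert T (j + 2)).im - (τ.vert T j).im) := by
      rw [Complex.sub_im]; linarith
    rw [hu, sq, Complex.mul_im, hre', him']
    have q0 := mul_nonneg (mul_nonneg hx hx) s0.le
    have q2 := mul_nonneg (mul_nonneg hy hy) s2.le
    -- The coefficient of `x * y` in the product of the coordinates of `u - τ.vert T j` is the sum
    -- of the products for the two sides at the vertex minus that for the third side.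
    have q1 := mul_nonneg (mul_nonneg hx hy) (add_nonneg (add_nonneg s0.le s2.le)
      (neg_nonneg.mpr s1))
    linarith
  have hnear : ∀ᶠ y in 𝓝 z, 0 ≤ s * (ψ y ^ k).im := by
    filter_upwards [hface, ((X.finite_Z.subset Set.sdiff_subset).isClosed.isOpen_compl.mem_nhds
      (fun h => h.2 rfl : z ∉ X.Z \ {z}))] with y hy1 hy2
    by_cases hyZ : y ∈ X.Z
    · have hyz : y = z := by
        by_contra hne
        exact hy2 ⟨hyZ, hne⟩
      rw [hyz, hψ0, zero_pow (by omega)]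
      simp
    · obtain ⟨T, hyT⟩ := τ.exists_mem_image_triangle hyZ
      exact hy1 T hyT
  -- Along the ray through `r` the number `ψ ^ k` is a positive multiple of `-s * I`, a direction
  -- that the faces leave uncovered.
  obtain ⟨r, hr⟩ := IsAlgClosed.exists_pow_nat_eq (-(s : ℂ) * Complex.I) (n := k) hk
  have ht : Filter.Tendsto (fun δ : ℝ => (δ : ℂ) * r) (𝓝[>] 0) (𝓝 (ψ z)) := by
    have : Filter.Tendsto (fun δ : ℝ => (δ : ℂ) * r) (𝓝 0) (𝓝 (((0 : ℝ) : ℂ) * r)) :=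
      Continuous.tendsto (by fun_prop) _
    rw [Complex.ofReal_zero, zero_mul, ← hψ0] at this
    exact this.mono_left nhdsWithin_le_nhds
  have hsymm := ψ.symm.continuousAt (ψ.map_source hzψ)
  rw [ContinuousAt, ψ.left_inv hzψ] at hsymm
  obtain ⟨δ, ⟨h1, h2⟩, h3⟩ := (((hsymm.comp ht).eventually hnear).and
    (ht.eventually (ψ.open_target.mem_nhds (ψ.map_source hzψ)))).and self_mem_nhdsWithin |>.exists
  simp only [Function.comp] at h1
  rw [ψ.right_inv h2, mul_pow, hr, ← Complex.ofReal_pow, Complex.im_ofReal_mul] at h1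
  have h3' : 0 < δ ^ k := pow_pos h3 k
  have h4 : 0 < s * s := mul_self_pos.mpr hs
  simp at h1
  nlinarith [mul_pos h3' h4]

/-- Edges are coloured by the sign of `re * im`; the factor `s = 1` treats red and `s = -1` blue. -/
theorem isVeering_of_isDiagonalOfImmersedRectangle [T2Space S]
    (hd : ∀ e, (τ.edge e).IsDiagonalOfImmersedRectangle) : τ.IsVeering := by
  classical
  have hne := fun e => (hd e).re_mul_im_ne_zero
  let col : τ.Edge → Colour := fun e =>
    if 0 < (τ.edge e).hol.re * (τ.edge e).hol.im then Colour.red else Colour.blue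
  have hred : ∀ e, col e = Colour.red → 0 < (1 : ℝ) * ((τ.edge e).hol.re * (τ.edge e).hol.im) := by
    intro e he
    by_contra hcon
    rw [one_mul] at hcon
    simp [col, hcon] at he
  have hblue : ∀ e, col e = Colour.blue →
      0 < (-1 : ℝ) * ((τ.edge e).hol.re * (τ.edge e).hol.im) := by
    intro e he
    by_contra hcon
    have : 0 < (τ.edge e).hol.re * (τ.edge e).hol.im :=
      lt_of_le_of_ne (by linarith) (hne e).symm
    simp [col, this] at he
  have hmatch : τ.MatchesSlopes col := by
    refine fun e => ⟨fun he => ⟨left_ne_zero_of_mul (hne e), ?_⟩,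
      fun he => ⟨left_ne_zero_of_mul (hne e), ?_⟩⟩
    · have := hred e he
      rcases mul_pos_iff.mp (by linarith : 0 < (τ.edge e).hol.re * (τ.edge e).hol.im) with
        ⟨h1, h2⟩ | ⟨h1, h2⟩
      · exact div_pos h2 h1
      · exact div_pos_of_neg_of_neg h2 h1
    · have := hblue e he
      rcases mul_neg_iff.mp (by linarith : (τ.edge e).hol.re * (τ.edge e).hol.im < 0) with
        ⟨h1, h2⟩ | ⟨h1, h2⟩
      · exact div_neg_of_neg_of_pos h2 h1
      · exact div_neg_of_pos_of_neg h2 h1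
  refine ⟨col, hmatch, ?_, ?_⟩
  · rintro T ⟨c, hc⟩
    cases c
    · exact τ.not_monochromatic_face hd 1 T fun i => hred _ (hc i)
    · exact τ.not_monochromatic_face hd (-1) T fun i => hblue _ (hc i)
  · rintro z hz ⟨c, hc⟩
    cases c
    · exact τ.not_monochromatic_vertex one_ne_zero (τ.not_monochromatic_face hd 1) hz
        fun e he => hred _ (hc e he)
    · exact τ.not_monochromatic_vertex (by norm_num) (τ.not_monochromatic_face hd (-1)) hz
        fun e he => hblue _ (hc e he)

end StraightTriangulation

end HalfTranslationSurface

theorem lemma2p10 {S : Type*} [TopologicalSpace S] [T2Space S] [CompactSpace S] [ConnectedSpace S]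
    (X : HalfTranslationSurface S) (τ : X.StraightTriangulation) :
    τ.IsVeering ↔ ∀ e : τ.Edge, (τ.edge e).IsDiagonalOfImmersedRectangle :=
  ⟨fun h e => h.isDiagonalOfImmersedRectangle e, τ.isVeering_of_isDiagonalOfImmersedRectangle⟩
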